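/- **Setting.** Let $d\ge 1$, $X=\mathbb Z^d$, and let $(p(x,y))_{x,y\in X}$ be an irreducible, translation-invariant transition probability. Let $g^k_{\alpha,\beta}\ge 0$ ($k,\alpha,\beta\in\mathbb N=\{0,1,2,\dots\}$) be rates with $g^0_{\alpha,\beta}=0$ and $g^k_{\alpha,\beta}=0$ for $k>\alpha$, such that for some constant $C>0$ $$\sum_{k=1}^{\alpha}k\,g^k_{\alpha,\beta}\le C(\alpha+\beta)\qquad\text{for all }\alpha>0,\ \beta\ge 0 .$$ Let $a:X\to(0,\infty)$ satisfy $\sum_x a_x<\infty$ and, for some constant $M$, $\sum_y p(x,y)a_y+\sum_y a_yp(y,x)\le M a_x$ for all $x$. Put $\mathfrak X=\{\eta\in\mathbb N^X:\|\eta\|=\sum_x\eta(x)a_x<\infty\}$ and $\|\eta-\zeta\|=\sum_x|\eta(x)-\zeta(x)|a_x$, and let $\mathbf L$ be the set of functions $f:\mathfrak X\to\mathbb R$ that are Lipschitz for this distance. For $f\in\mathbf L$ let $$\mathcal L f(\eta)=\sum_{x,y\in X}\sum_{k>0}p(x,y)\,g^k_{\eta(x),\eta(y)}\bigl(f(S^k_{x,y}\eta)-f(\eta)\bigr),$$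 where $S^k_{x,y}\eta$ is $\eta$ after $k$ particles have moved from $x$ to $y$ (and $S^k_{x,y}\eta=\eta$ if $\eta(x)<k$ or $x=y$). A *mass migration process* (MMP) with generator $\mathcal L$ is a Markov process on $\mathfrak X$ whose transition semigroup $S(t)f(\eta)=\mathbb E^\eta f(\eta_t)$, $t\ge 0$, is well defined on $\mathbf L$, maps $\mathbf L$ into $\mathbf L$, and satisfies $S(t)f(\eta)=f(\eta)+\int_0^t S(s)\mathcal L f(\eta)\,ds$ for all $f\in\mathbf L$, $\eta\in\mathfrak X$, $t\ge 0$. A probability measure $\bar\mu$ on $\mathbb N^X$ is *invariant* for it if $\bar\mu(\mathfrak X)=1$ and $\int S(t)f\,d\bar\mu=\int f\,d\bar\mu$ for every bounded $f\in\mathbf L$ and every $t\ge 0$. **Theorem.** Consider such an MMP. Let $\bar\mu$ be the translation-invariant product probability measure on $\mathbb N^{\mathbb Z^d}$ with single site marginal $\mu$, where $\sum_n n\mu(n)<\infty$. For $\alpha,\beta\ge 0$ let $$A(\alpha,\beta)=\sum_{k\le\beta}g^k_{\alpha+k,\beta-k}\frac{\mu(\alpha+k)\mu(\beta-k)}{\mu(\alpha)\mu(\beta)}-\sum_{k\le\alpha}g^k_{\alpha,\beta}\quad\text{if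 }\mu(\alpha)\mu(\beta)\ne 0,\qquad A(\alpha,\beta)=0\ \text{ otherwise.}$$ Consider the conditions 1. $\sum_{k\le\beta}g^k_{\alpha+k,\beta-k}\,\mu(\alpha+k)\mu(\beta-k)=0$ for all $\alpha,\beta$ with $\mu(\alpha)\mu(\beta)=0$; 2. $A(\alpha,\beta)=-A(\beta,\alpha)$ for all $\alpha,\beta$; 3. there is a function $\psi:\mathbb N\to\mathbb R$ such that $A(\alpha,\beta)=\psi(\beta)-\psi(\alpha)$ for all $\alpha,\beta$ with $\mu(\alpha)\mu(\beta)\ne 0$. If $\bar\mu$ is invariant, then (1) and (2) hold. If $p$ is symmetric ($p(x,y)=p(y,x)$ for all $x,y$), then $\bar\mu$ is invariant if and only if (1) and (2) hold. If $p$ is not symmetric, then $\bar\mu$ is invariant if and only if (1) and (3) hold. -/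

import Mathlib

open MeasureTheory ProbabilityTheory
open scoped NNReal

namespace MMP

noncomputable section

/-- `p x y`, for `x y : X`, is a transition probability on the countable set `X` of sites. -/
structure IsTransitionProbability {X : Type*} (p : X → X → ℝ) : Prop where
  nonneg : ∀ x y, 0 ≤ p x y
  hasSum : ∀ x, HasSum (p x) 1

/-- Any site can be reached from any other one by finitely many steps of positive probability. -/
def IsIrreducible {X : Type*} (p : X → X → ℝ) : Prop :=
  ∀ x y, Relation.ReflTransGen (fun u v => 0 < p u v) x y

def IsTranslationInvariant {X : Type*} [Add X] (p : X → X → ℝ) : Prop :=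
  ∀ x y z, p (x + z) (y + z) = p x y

def IsSymmetric {X : Type*} (p : X → X → ℝ) : Prop :=
  ∀ x y, p x y = p y x

/-- A family of rates: `g k α β` is the rate at which `k` particles jump together from a site
with `α` particles to a site with `β` particles (up to the factor `p x y`). -/
structure IsRate (g : ℕ → ℕ → ℕ → ℝ) : Prop where
  zero : ∀ α β, g 0 α β = 0
  nonneg : ∀ k α β, 0 ≤ g k α β
  eq_zero_of_lt : ∀ k α β, α < k → g k α β = 0

/-- The linear growth bound on the rates. -/
def LinearGrowth (g : ℕ → ℕ → ℕ → ℝ) : Prop :=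
  ∃ C : ℝ, 0 < C ∧ ∀ α β : ℕ, 0 < α →
    ∑ k ∈ Finset.Icc 1 α, (k : ℝ) * g k α β ≤ C * ((α : ℝ) + (β : ℝ))

/-- A positive summable weight on the sites that is adapted to `p`. Both series converge, since
`a` is summable and `0 ≤ p ≤ 1`. -/
structure IsWeight {X : Type*} (p : X → X → ℝ) (a : X → ℝ) : Prop where
  pos : ∀ x, 0 < a x
  summable : Summable a
  bound : ∃ M : ℝ, ∀ x, ∑' y, p x y * a y + ∑' y, a y * p y x ≤ M * a x

/-- The state space: the configurations `η` with `∑ x, η x * a x < ∞`. It carries the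
σ-algebra induced by the product σ-algebra of `X → ℕ`. -/
abbrev Config {X : Type*} (a : X → ℝ) : Type _ :=
  {η : X → ℕ // Summable fun x => (η x : ℝ) * a x}

/-- The distance `‖η - ζ‖ = ∑ x, |η x - ζ x| * a x`. -/
def wdist {X : Type*} {a : X → ℝ} (η ζ : Config a) : ℝ :=
  ∑' x, |(η.1 x : ℝ) - (ζ.1 x : ℝ)| * a x

/-- `f` is Lipschitz on the state space. -/
def IsLip {X : Type*} {a : X → ℝ} (f : Config a → ℝ) : Prop :=
  ∃ L : ℝ, 0 < L ∧ ∀ η ζ, |f η - f ζ| ≤ L * wdist η ζ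

/-- The configuration obtained when `k` particles jump from `x` to `y`; nothing happens when there
are fewer than `k` particles at `x`, or when `x = y`. -/
def jumpFun {X : Type*} [DecidableEq X] (k : ℕ) (x y : X) (η : X → ℕ) : X → ℕ :=
  if k ≤ η x then fun z => η z - (if z = x then k else 0) + (if z = y then k else 0) else η

theorem summable_jumpFun {X : Type*} [DecidableEq X] {a : X → ℝ} (k : ℕ) (x y : X) (η : X → ℕ)
    (h : Summable fun z => (η z : ℝ) * a z) :
    Summable fun z => (jumpFun k x y η z : ℝ) * a z := by
  refine (summable_congr_cofinite ?_).1 h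
  have hfin : ({x, y} : Set X).Finite := by simp
  filter_upwards [hfin.compl_mem_cofinite] with z hz
  simp only [Set.mem_compl_iff, Set.mem_insert_iff, Set.mem_singleton_iff, not_or] at hz
  unfold jumpFun
  split_ifs <;> simp [hz.1, hz.2]

/-- The jump of `k` particles from `x` to `y`, on the state space. -/
def jump {X : Type*} [DecidableEq X] {a : X → ℝ} (k : ℕ) (x y : X) (η : Config a) : Config a :=
  ⟨jumpFun k x y η.1, summable_jumpFun k x y η.1 η.2⟩

/-- The generator of the mass migration process. Jumps of more than `η x` particles
from `x` have rate zero. -/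
def generator {X : Type*} [DecidableEq X] {a : X → ℝ} (p : X → X → ℝ) (g : ℕ → ℕ → ℕ → ℝ)
    (f : Config a → ℝ) (η : Config a) : ℝ :=
  ∑' xy : X × X, ∑ k ∈ Finset.Icc 1 (η.1 xy.1),
    p xy.1 xy.2 * g k (η.1 xy.1) (η.1 xy.2) * (f (jump k xy.1 xy.2 η) - f η)

/-- The action of a family of transition kernels on functions, `S(t) f (η) = E^η f(η_t)`. -/
def act {X : Type*} {a : X → ℝ} (P : ℝ≥0 → Kernel (Config a) (Config a)) (t : ℝ≥0)
    (f : Config a → ℝ) (η : Config a) : ℝ :=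
  ∫ ξ, f ξ ∂(P t η)

/-- `P` is the transition function of a mass migration process with jump probabilities `p` and
rates `g`: a Markov transition semigroup that acts on the Lipschitz functions and solves the
martingale problem (Dynkin's formula) of the generator on them. -/
structure IsProcess {X : Type*} [DecidableEq X] {a : X → ℝ} (p : X → X → ℝ)
    (g : ℕ → ℕ → ℕ → ℝ) (P : ℝ≥0 → Kernel (Config a) (Config a)) : Prop where
  markov : ∀ t, IsMarkovKernel (P t)
  zero : P 0 = Kernel.id
  add : ∀ s t, P (s + t) = (P t).comp (P s)
  integrable : ∀ f, IsLip f → ∀ t η, Integrable f (P t η)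
  isLip : ∀ f, IsLip f → ∀ t, IsLip (act P t f)
  dynkin : ∀ f, IsLip f → ∀ (t : ℝ≥0) (η : Config a),
    IntervalIntegrable (fun s : ℝ => act P s.toNNReal (generator p g f) η) volume 0 t ∧
    act P t f η = f η + ∫ s in (0 : ℝ)..t, act P s.toNNReal (generator p g f) η

/-- A measure on `X → ℕ` is invariant for the process with transition function `P`: it is carried by
the state space, and it is preserved by the semigroup, tested on bounded Lipschitz functions. -/
def IsInvariant {X : Type*} {a : X → ℝ} (P : ℝ≥0 → Kernel (Config a) (Config a))
    (ν : Measure (X → ℕ)) : Prop :=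
  (∀ᵐ η ∂ν, Summable fun x => (η x : ℝ) * a x) ∧
  ∀ f : Config a → ℝ, IsLip f → (∃ B : ℝ, ∀ η, |f η| ≤ B) → ∀ t : ℝ≥0,
    ∫ η, act P t f η ∂(ν.comap Subtype.val) = ∫ η, f η ∂(ν.comap Subtype.val)

/-- The quantity `A(α, β)` of the rates `g` and the single site marginal `m`. -/
def A (g : ℕ → ℕ → ℕ → ℝ) (m : ℕ → ℝ) (α β : ℕ) : ℝ :=
  if m α * m β ≠ 0 then
    ∑ k ∈ Finset.range (β + 1), g k (α + k) (β - k) * (m (α + k) * m (β - k) / (m α * m β))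
      - ∑ k ∈ Finset.range (α + 1), g k α β
  else 0

/-- No jump leads from the support of the product measure to a pair of values outside of it. -/
def SupportCondition (g : ℕ → ℕ → ℕ → ℝ) (m : ℕ → ℝ) : Prop :=
  ∀ α β : ℕ, m α * m β = 0 →
    ∑ k ∈ Finset.range (β + 1), g k (α + k) (β - k) * m (α + k) * m (β - k) = 0

end

end MMP

namespace MMP

open Filter Topology

/-! ### Double sums over pairs of sites against a doubly stochastic matrix. -/

section Sums

variable {X : Type*} {p : X → X → ℝ} {a : X → ℝ}

/-! Invariance is first moved to the generator. The semigroup keeps bounded Lipschitz functions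
bounded and Lipschitz, so by Dynkin's formula `t ↦ ∫ S(t)f dμ̄` has right derivative `∫ 𝓛 S(t)f
dμ̄`. Hence invariance means `∫ 𝓛 f dμ̄ = 0` for bounded Lipschitz `f` (`integral_act_eq_iff`).
Truncating configurations reduces this to bounded `f` of finitely many coordinates
(`integral_generator_eq_zero`). For these, a change of variables moves the jumps from `f` to the
measure (`exists_hasSum_flux`, `integral_jumpSum`), and `∫ 𝓛 f dμ̄` becomes the sum over `u ≠ v` of
`p(u,v) ∑ Φ(α,β) E(α,β)`. Here `Φ` is `flux`, and `E(α,β)` is the mean of `f` with the values at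
`u`, `v` set to `α`, `β`. Under (1), `Φ(α,β) = μ(α)μ(β)A(α,β)`.

Necessity. Take for `f` the indicator of `η x = α`, `η y = β`. If `μ(α)μ(β) = 0`, nothing can be
lost, every term is nonnegative, and the vanishing gain is (1) (`supportCondition_of_hasSum`). In
general put `r(α) = ∑_β Φ(α,β)`. Functions of one site give `∑_β Φ(β,α) = -r(α)`, and the indicators
then give `p(x,y) D(α,β) + p(y,x) D(β,α) = 0`, where `D(α,β) = Φ(α,β) - r(α)μ(β) + r(β)μ(α)`
(`flux_balance`). Adding the same equation with `α`, `β` exchanged yields (2). If `p(x,y) ≠ p(y,x)`,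
the two equations force `D = 0`, which is (3) with `ψ = -r/μ`.

Sufficiency. If `p` is symmetric and `A` antisymmetric, exchanging `u` and `v` changes the sign of
the whole sum (`tsum_mul_pairFlux_of_symmetric`). Under (3) the contribution of `(u,v)` is
`p(u,v)(h(v) - h(u))`, where `h(u)` is the mean of `ψ(η u) f`. By independence `h` is constant off
the finite support of `f`, so the sum vanishes because rows and columns of `p` both sum to one
(`hasSum_mul_sub`). -/

theorem IsTransitionProbability.le_one (hp : IsTransitionProbability p) (x y : X) : p x y ≤ 1 :=
  le_hasSum (hp.hasSum x) y fun z _ => hp.nonneg x z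

theorem hasSum_row (hp : IsTransitionProbability p) {c : X → ℝ} (hc : ∀ x, 0 ≤ c x)
    (hs : Summable c) : HasSum (fun q : X × X => p q.1 q.2 * c q.1) (∑' x, c x) := by
  have h1 : ∀ x, HasSum (fun y => p x y * c x) (c x) := fun x => by
    simpa using (hp.hasSum x).mul_right (c x)
  have h : Summable (fun q : X × X => p q.1 q.2 * c q.1) := by
    refine (summable_prod_of_nonneg fun q => mul_nonneg (hp.nonneg _ _) (hc _)).2
      ⟨fun x => (h1 x).summable, ?_⟩
    simpa only [(h1 _).tsum_eq] using hs
  have := h.hasSum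
  rwa [h.tsum_prod' fun x => (h1 x).summable, tsum_congr fun x => (h1 x).tsum_eq] at this

theorem hasSum_col (hp : IsTransitionProbability p) (hcol : ∀ y, HasSum (fun x => p x y) 1)
    {c : X → ℝ} (hc : ∀ x, 0 ≤ c x) (hs : Summable c) :
    HasSum (fun q : X × X => p q.1 q.2 * c q.2) (∑' x, c x) := by
  have := hasSum_row (p := fun x y => p y x) ⟨fun x y => hp.nonneg y x, hcol⟩ hc hs
  exact (Equiv.prodComm X X).hasSum_iff.1 this

theorem IsWeight.summable_row (hp : IsTransitionProbability p) (ha : IsWeight p a) (x : X) :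
    Summable fun y => p x y * a y :=
  Summable.of_nonneg_of_le (fun y => mul_nonneg (hp.nonneg _ _) (ha.pos y).le)
    (fun y => mul_le_of_le_one_left (ha.pos y).le (hp.le_one x y)) ha.summable

theorem IsWeight.summable_col (hp : IsTransitionProbability p) (ha : IsWeight p a) (x : X) :
    Summable fun y => a y * p y x :=
  Summable.of_nonneg_of_le (fun y => mul_nonneg (ha.pos y).le (hp.nonneg _ _))
    (fun y => mul_le_of_le_one_right (ha.pos y).le (hp.le_one y x)) ha.summable

/-- The weight of the transport between the two sites of a pair. -/
noncomputable def pairWeight (p : X → X → ℝ) (a : X → ℝ) (q : X × X) : ℝ :=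
  p q.1 q.2 * (a q.1 + a q.2)

theorem pairWeight_nonneg (hp : IsTransitionProbability p) (ha : IsWeight p a) (q : X × X) :
    0 ≤ pairWeight p a q :=
  mul_nonneg (hp.nonneg _ _) (add_nonneg (ha.pos _).le (ha.pos _).le)

/-- This bound controls all series over pairs below. It is applied with `c = η` for growth of the
generator and with `c = |ξ - η|` for its continuity. -/
theorem exists_pairWeight_bound (hp : IsTransitionProbability p)
    (hcol : ∀ y, HasSum (fun x => p x y) 1) (ha : IsWeight p a) :
    ∃ K : ℝ, 0 < K ∧ ∀ c : X → ℝ, (∀ x, 0 ≤ c x) → (Summable fun x => c x * a x) →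
      (Summable fun q : X × X => pairWeight p a q * (c q.1 + c q.2)) ∧
      ∑' q : X × X, pairWeight p a q * (c q.1 + c q.2) ≤ K * ∑' x, c x * a x := by
  obtain ⟨M, hM⟩ := ha.bound
  -- The diagonal products `c x * a x` and `c y * a y` contribute `2`, the cross products `M`. The
  -- maximum only serves positivity.
  refine ⟨max (2 + M) 1, by positivity, fun c hc hs => ?_⟩
  have hca : ∀ x, 0 ≤ c x * a x := fun x => mul_nonneg (hc x) (ha.pos x).le
  have h1 := hasSum_row hp hca hs
  have h2 := hasSum_col hp hcol hca hs
  set r : X → ℝ := fun x => ∑' y, p x y * a y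
  set s : X → ℝ := fun x => ∑' y, a y * p y x
  have hr0 : ∀ x, 0 ≤ r x := fun x => tsum_nonneg fun y => mul_nonneg (hp.nonneg _ _) (ha.pos y).le
  have hs0 : ∀ x, 0 ≤ s x := fun x => tsum_nonneg fun y => mul_nonneg (ha.pos y).le (hp.nonneg _ _)
  have hM' : ∀ x, c x * r x + c x * s x ≤ M * (c x * a x) := fun x => by
    have := mul_le_mul_of_nonneg_left (hM x) (hc x)
    simp only [r, s]; linarith
  have hcr : Summable fun x => c x * r x :=
    Summable.of_nonneg_of_le (fun x => mul_nonneg (hc x) (hr0 x))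
      (fun x => by have := hM' x; have := mul_nonneg (hc x) (hs0 x); linarith) (hs.mul_left M)
  have hcs : Summable fun x => c x * s x :=
    Summable.of_nonneg_of_le (fun x => mul_nonneg (hc x) (hs0 x))
      (fun x => by have := hM' x; have := mul_nonneg (hc x) (hr0 x); linarith) (hs.mul_left M)
  have h3 : HasSum (fun q : X × X => c q.1 * (p q.1 q.2 * a q.2)) (∑' x, c x * r x) := by
    have hin : ∀ x, HasSum (fun y => c x * (p x y * a y)) (c x * r x) := fun x =>
      (ha.summable_row hp x).hasSum.mul_left _
    have h : Summable (fun q : X × X => c q.1 * (p q.1 q.2 * a q.2)) := by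
      refine (summable_prod_of_nonneg fun q =>
        mul_nonneg (hc _) (mul_nonneg (hp.nonneg _ _) (ha.pos _).le)).2
        ⟨fun x => (hin x).summable, ?_⟩
      simpa only [(hin _).tsum_eq] using hcr
    have := h.hasSum
    rwa [h.tsum_prod' fun x => (hin x).summable, tsum_congr fun x => (hin x).tsum_eq] at this
  have h4 : HasSum (fun q : X × X => c q.2 * (a q.1 * p q.1 q.2)) (∑' x, c x * s x) := by
    have hin : ∀ x, HasSum (fun y => c x * (a y * p y x)) (c x * s x) := fun x =>
      (ha.summable_col hp x).hasSum.mul_left _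
    have h : Summable (fun q : X × X => c q.1 * (a q.2 * p q.2 q.1)) := by
      refine (summable_prod_of_nonneg fun q =>
        mul_nonneg (hc _) (mul_nonneg (ha.pos _).le (hp.nonneg _ _))).2
        ⟨fun x => (hin x).summable, ?_⟩
      simpa only [(hin _).tsum_eq] using hcs
    have h' := h.hasSum
    rw [h.tsum_prod' fun x => (hin x).summable, tsum_congr fun x => (hin x).tsum_eq] at h'
    exact (Equiv.prodComm X X).hasSum_iff.1 h'
  have hall := ((h1.add h2).add h3).add h4
  have heq : (fun q : X × X => p q.1 q.2 * (c q.1 * a q.1) + p q.1 q.2 * (c q.2 * a q.2) +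
      c q.1 * (p q.1 q.2 * a q.2) + c q.2 * (a q.1 * p q.1 q.2)) =
      fun q : X × X => pairWeight p a q * (c q.1 + c q.2) := by
    funext q; simp only [pairWeight]; ring
  rw [heq] at hall
  refine ⟨hall.summable, ?_⟩
  rw [hall.tsum_eq]
  have h5 : ∑' x, c x * r x + ∑' x, c x * s x ≤ M * ∑' x, c x * a x := by
    rw [← hcr.tsum_add hcs, ← tsum_mul_left]
    exact (hcr.add hcs).tsum_le_tsum hM' (hs.mul_left M)
  have h6 : 0 ≤ ∑' x, c x * a x := tsum_nonneg hca
  nlinarith [le_max_left (2 + M) 1]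

end Sums

/-! ### The weighted distance, the weighted norm, and jumps. -/

section Distance

variable {X : Type*} {p : X → X → ℝ} {a : X → ℝ}

/-- The weighted number of particles. -/
noncomputable def wnorm (η : Config a) : ℝ := ∑' x, (η.1 x : ℝ) * a x

theorem wdist_term_nonneg (ha : IsWeight p a) (η ζ : Config a) (x : X) :
    0 ≤ |(η.1 x : ℝ) - (ζ.1 x : ℝ)| * a x :=
  mul_nonneg (abs_nonneg _) (ha.pos x).le

theorem summable_wdist (ha : IsWeight p a) (η ζ : Config a) :
    Summable fun x => |(η.1 x : ℝ) - (ζ.1 x : ℝ)| * a x := by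
  refine Summable.of_nonneg_of_le (wdist_term_nonneg ha η ζ) (fun x => ?_) (η.2.add ζ.2)
  rw [← add_mul]
  refine mul_le_mul_of_nonneg_right ?_ (ha.pos x).le
  refine (abs_sub _ _).trans ?_
  simp

theorem wdist_nonneg (ha : IsWeight p a) (η ζ : Config a) : 0 ≤ wdist η ζ :=
  tsum_nonneg (wdist_term_nonneg ha η ζ)

theorem wdist_self (η : Config a) : wdist η η = 0 := by
  simp [wdist]

theorem wdist_comm (η ζ : Config a) : wdist η ζ = wdist ζ η := by
  simp only [wdist, abs_sub_comm]

theorem wdist_triangle (ha : IsWeight p a) (η ζ ξ : Config a) :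
    wdist η ξ ≤ wdist η ζ + wdist ζ ξ := by
  rw [wdist, wdist, wdist, ← (summable_wdist ha _ _).tsum_add (summable_wdist ha _ _)]
  refine (summable_wdist ha _ _).tsum_le_tsum (fun x => ?_)
    ((summable_wdist ha _ _).add (summable_wdist ha _ _))
  rw [← add_mul]
  exact mul_le_mul_of_nonneg_right (abs_sub_le _ _ _) (ha.pos x).le

theorem abs_sub_mul_le_wdist (ha : IsWeight p a) (η ζ : Config a) (x : X) :
    |(η.1 x : ℝ) - (ζ.1 x : ℝ)| * a x ≤ wdist η ζ :=
  (summable_wdist ha η ζ).le_tsum x fun y _ => wdist_term_nonneg ha η ζ y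

/-- Occupation numbers are integers, so a discrepancy at `x` costs at least `a x`. -/
theorem eq_of_wdist_lt (ha : IsWeight p a) {η ζ : Config a} {x : X} (h : wdist η ζ < a x) :
    η.1 x = ζ.1 x := by
  have h1 := (abs_sub_mul_le_wdist ha η ζ x).trans_lt h
  have h2 : |(η.1 x : ℝ) - (ζ.1 x : ℝ)| < 1 := by
    have := ha.pos x
    by_contra hc
    push Not at hc
    nlinarith
  have h3 : |((η.1 x : ℤ) - (ζ.1 x : ℤ))| < 1 := by exact_mod_cast h2
  have := Int.abs_lt_one_iff.1 h3
  omega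

theorem wnorm_nonneg (ha : IsWeight p a) (η : Config a) : 0 ≤ wnorm η :=
  tsum_nonneg fun x => mul_nonneg (Nat.cast_nonneg _) (ha.pos x).le

theorem abs_wnorm_sub_le (ha : IsWeight p a) (η ζ : Config a) :
    |wnorm η - wnorm ζ| ≤ wdist η ζ := by
  rw [wnorm, wnorm, ← η.2.tsum_sub ζ.2, wdist]
  have h : ∀ x, ‖(η.1 x : ℝ) * a x - (ζ.1 x : ℝ) * a x‖ =
      |(η.1 x : ℝ) - (ζ.1 x : ℝ)| * a x := fun x => by
    rw [← sub_mul, Real.norm_eq_abs, abs_mul, abs_of_pos (ha.pos x)]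
  have := norm_tsum_le_tsum_norm (f := fun x => (η.1 x : ℝ) * a x - (ζ.1 x : ℝ) * a x)
    (by simpa only [h] using summable_wdist ha η ζ)
  simpa only [h, Real.norm_eq_abs] using this

theorem isLip_wnorm (ha : IsWeight p a) : IsLip (wnorm (a := a)) :=
  ⟨1, one_pos, fun η ζ => by simpa using abs_wnorm_sub_le ha η ζ⟩

theorem isLip_wdist (ha : IsWeight p a) (η : Config a) : IsLip fun ξ => wdist ξ η := by
  refine ⟨1, one_pos, fun ξ ζ => ?_⟩
  rw [one_mul, abs_sub_le_iff]
  have h1 := wdist_triangle ha ξ ζ η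
  have h2 := wdist_triangle ha ζ ξ η
  rw [wdist_comm ζ ξ] at h2
  constructor <;> linarith

theorem wdist_le_wnorm_add (ha : IsWeight p a) (η ζ : Config a) :
    wdist η ζ ≤ wnorm η + wnorm ζ := by
  rw [wdist, wnorm, wnorm, ← η.2.tsum_add ζ.2]
  refine (summable_wdist ha η ζ).tsum_le_tsum (fun x => ?_) (η.2.add ζ.2)
  rw [← add_mul]
  refine mul_le_mul_of_nonneg_right ?_ (ha.pos x).le
  refine (abs_sub _ _).trans ?_
  simp

/-- The empty configuration. -/
def emptyConfig : Config a := ⟨0, by simp⟩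

theorem wnorm_emptyConfig : wnorm (emptyConfig : Config a) = 0 := by
  simp [wnorm, emptyConfig]

theorem IsLip.abs_le {f : Config a → ℝ} (hf : IsLip f) (ha : IsWeight p a) :
    ∃ L : ℝ, 0 < L ∧ ∀ η, |f η| ≤ |f emptyConfig| + L * wnorm η := by
  obtain ⟨L, hL, h⟩ := hf
  refine ⟨L, hL, fun η => ?_⟩
  have h1 := h η emptyConfig
  have h2 := wdist_le_wnorm_add ha η emptyConfig
  rw [wnorm_emptyConfig] at h2
  have h3 := abs_sub_abs_le_abs_sub (f η) (f emptyConfig)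
  nlinarith

variable [DecidableEq X]

theorem wdist_jump_self (ha : IsWeight p a) (k : ℕ) (x y : X) (η : Config a) :
    wdist (jump k x y η) η ≤ k * (a x + a y) := by
  have hx := (ha.pos x).le
  have hy := (ha.pos y).le
  have hs : HasSum (fun z => (if z = x then (k : ℝ) * a x else 0) +
      (if z = y then (k : ℝ) * a y else 0)) (k * a x + k * a y) :=
    (hasSum_ite_eq x _).add (hasSum_ite_eq y _)
  rw [mul_add, ← hs.tsum_eq, wdist]
  refine (summable_wdist ha _ _).tsum_le_tsum (fun z => ?_) hs.summable
  have hz := (ha.pos z).le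
  have hR : (if z = x then (k : ℝ) * a x else 0) + (if z = y then (k : ℝ) * a y else 0) =
      ((if z = x then (k : ℝ) else 0) + (if z = y then (k : ℝ) else 0)) * a z := by
    split_ifs <;> simp_all [add_mul]
  rw [hR]
  refine mul_le_mul_of_nonneg_right ?_ hz
  simp only [jump, jumpFun]
  by_cases h : k ≤ η.1 x
  · by_cases h1 : z = x
    · by_cases h2 : z = y
      · subst h1 h2; simp [h]
      · subst h1; simp [h, h2, Nat.cast_sub h]
    · by_cases h2 : z = y <;> simp [h, h1, h2]
      simp [← h2, h1]
  · simp only [h, if_false, sub_self, abs_zero]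
    split_ifs <;> simp

theorem wdist_jump_jump (k : ℕ) (x y : X) {η ζ : Config a} (hx : η.1 x = ζ.1 x)
    (hy : η.1 y = ζ.1 y) : wdist (jump k x y η) (jump k x y ζ) = wdist η ζ := by
  refine tsum_congr fun z => ?_
  congr 2
  simp only [jump, jumpFun, hx]
  by_cases h : k ≤ ζ.1 x
  · simp only [h, if_true]
    by_cases h1 : z = x
    · subst h1; simp [hx]
    · by_cases h2 : z = y
      · subst h2; simp [hy]
      · simp [h1, h2]
  · simp [h]

end Distance

end MMP

namespace MMP

open Filter Topology

section Rates

variable {g : ℕ → ℕ → ℕ → ℝ}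

/-- The bound of the linear growth condition, with constant `C`, for all occupation numbers. -/
def GrowthBound (g : ℕ → ℕ → ℕ → ℝ) (C : ℝ) : Prop :=
  0 < C ∧ ∀ α β : ℕ, ∑ k ∈ Finset.Icc 1 α, (k : ℝ) * g k α β ≤ C * ((α : ℝ) + (β : ℝ))

theorem LinearGrowth.exists_growthBound (h : LinearGrowth g) : ∃ C, GrowthBound g C := by
  obtain ⟨C, hC, h⟩ := h
  refine ⟨C, hC, fun α β => ?_⟩
  rcases Nat.eq_zero_or_pos α with rfl | hα
  · simpa using mul_nonneg hC.le β.cast_nonneg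
  · exact h α β hα

theorem GrowthBound.sum_le {C : ℝ} (hC : GrowthBound g C) (hg : IsRate g) (α β : ℕ) :
    ∑ k ∈ Finset.Icc 1 α, g k α β ≤ C * ((α : ℝ) + (β : ℝ)) := by
  refine (Finset.sum_le_sum fun k hk => ?_).trans (hC.2 α β)
  have : (1 : ℝ) ≤ k := by exact_mod_cast (Finset.mem_Icc.1 hk).1
  exact le_mul_of_one_le_left (hg.nonneg _ _ _) this

end Rates

/-! ### Absolute convergence, linear growth and continuity of the generator. -/

section Generator

variable {X : Type*} {p : X → X → ℝ} {g : ℕ → ℕ → ℕ → ℝ} {a : X → ℝ}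

theorem summable_pairWeight (hp : IsTransitionProbability p)
    (hcol : ∀ y, HasSum (fun x => p x y) 1) (ha : IsWeight p a) (η : Config a) :
    Summable fun q : X × X => pairWeight p a q * ((η.1 q.1 : ℝ) + (η.1 q.2 : ℝ)) := by
  obtain ⟨K, -, hK⟩ := exists_pairWeight_bound hp hcol ha
  exact (hK (fun x => (η.1 x : ℝ)) (fun x => Nat.cast_nonneg _) η.2).1

variable [DecidableEq X]

/-- The contribution of the jumps between the two sites of a pair to the generator. -/
noncomputable def genTerm (p : X → X → ℝ) (g : ℕ → ℕ → ℕ → ℝ) (f : Config a → ℝ) (η : Config a)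
    (q : X × X) : ℝ :=
  ∑ k ∈ Finset.Icc 1 (η.1 q.1),
    p q.1 q.2 * g k (η.1 q.1) (η.1 q.2) * (f (jump k q.1 q.2 η) - f η)

theorem generator_eq_tsum (f : Config a → ℝ) (η : Config a) :
    generator p g f η = ∑' q, genTerm p g f η q := rfl

theorem abs_genTerm_le (hp : IsTransitionProbability p) (ha : IsWeight p a) (hg : IsRate g) {C : ℝ}
    (hC : GrowthBound g C) {f : Config a → ℝ} {L : ℝ} (hL : 0 < L)
    (hf : ∀ η ζ, |f η - f ζ| ≤ L * wdist η ζ) (η : Config a) (q : X × X) :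
    |genTerm p g f η q| ≤ L * C * (pairWeight p a q * ((η.1 q.1 : ℝ) + (η.1 q.2 : ℝ))) := by
  have hw := pairWeight_nonneg hp ha q
  calc |genTerm p g f η q| ≤ ∑ k ∈ Finset.Icc 1 (η.1 q.1),
        (L * pairWeight p a q) * ((k : ℝ) * g k (η.1 q.1) (η.1 q.2)) := by
        refine (Finset.abs_sum_le_sum_abs _ _).trans (Finset.sum_le_sum fun k _ => ?_)
        have h0 : 0 ≤ p q.1 q.2 * g k (η.1 q.1) (η.1 q.2) :=
          mul_nonneg (hp.nonneg _ _) (hg.nonneg _ _ _)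
        rw [abs_mul, abs_of_nonneg h0]
        have h1 : |f (jump k q.1 q.2 η) - f η| ≤ L * (k * (a q.1 + a q.2)) :=
          (hf _ _).trans (mul_le_mul_of_nonneg_left (wdist_jump_self ha k q.1 q.2 η) hL.le)
        refine (mul_le_mul_of_nonneg_left h1 h0).trans (le_of_eq ?_)
        simp only [pairWeight]; ring
    _ ≤ (L * pairWeight p a q) * (C * ((η.1 q.1 : ℝ) + (η.1 q.2 : ℝ))) := by
        rw [← Finset.mul_sum]
        exact mul_le_mul_of_nonneg_left (hC.2 _ _) (mul_nonneg hL.le hw)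
    _ = _ := by ring

theorem summable_genTerm (hp : IsTransitionProbability p)
    (hcol : ∀ y, HasSum (fun x => p x y) 1) (ha : IsWeight p a) (hg : IsRate g) {C : ℝ}
    (hC : GrowthBound g C) {f : Config a → ℝ} (hf : IsLip f) (η : Config a) :
    Summable (genTerm p g f η) := by
  obtain ⟨L, hL, hf⟩ := hf
  exact Summable.of_norm_bounded ((summable_pairWeight hp hcol ha η).mul_left (L * C))
    fun q => abs_genTerm_le hp ha hg hC hL hf η q

theorem exists_abs_generator_le (hp : IsTransitionProbability p)
    (hcol : ∀ y, HasSum (fun x => p x y) 1) (ha : IsWeight p a) (hg : IsRate g) {C : ℝ}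
    (hC : GrowthBound g C) :
    ∃ K : ℝ, 0 < K ∧ ∀ (f : Config a → ℝ) (L : ℝ), 0 < L →
      (∀ η ζ, |f η - f ζ| ≤ L * wdist η ζ) → ∀ η, |generator p g f η| ≤ L * K * wnorm η := by
  obtain ⟨K, hK0, hK⟩ := exists_pairWeight_bound hp hcol ha
  have hC0 := hC.1
  refine ⟨C * K, by positivity, fun f L hL hf η => ?_⟩
  have h := hK (fun x => (η.1 x : ℝ)) (fun x => Nat.cast_nonneg _) η.2
  rw [generator_eq_tsum]
  have h1 := tsum_of_norm_bounded (f := genTerm p g f η) ((h.1.mul_left (L * C)).hasSum)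
    fun q => abs_genTerm_le hp ha hg hC hL hf η q
  rw [tsum_mul_left] at h1
  rw [← mul_assoc L C K, mul_assoc]
  exact h1.trans (mul_le_mul_of_nonneg_left h.2 (by positivity))

/-- The rates need not be Lipschitz, so only continuity is available. Near `η` the finitely many
relevant occupation numbers coincide with those of `η`, which settles finite partial sums; the tails
are uniformly small. -/
theorem tendsto_generator (hp : IsTransitionProbability p)
    (hcol : ∀ y, HasSum (fun x => p x y) 1) (ha : IsWeight p a) (hg : IsRate g) {C : ℝ}
    (hC : GrowthBound g C) {f : Config a → ℝ} (hf : IsLip f) (η : Config a) :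
    Tendsto (generator p g f) (comap (fun ξ => wdist ξ η) (𝓝 0)) (𝓝 (generator p g f η)) := by
  have hsum := summable_genTerm hp hcol ha hg hC hf
  obtain ⟨L, hL, hf⟩ := hf
  obtain ⟨K, hK0, hK⟩ := exists_pairWeight_bound hp hcol ha
  have hC0 := hC.1
  set l := comap (fun ξ : Config a => wdist ξ η) (𝓝 0)
  have hl : Tendsto (fun ξ => wdist ξ η) l (𝓝 0) := tendsto_comap
  have hcoord : ∀ x, ∀ᶠ ξ in l, ξ.1 x = η.1 x := fun x => by
    filter_upwards [hl.eventually (gt_mem_nhds (ha.pos x))] with ξ hξ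
    exact eq_of_wdist_lt ha hξ
  have hterm : ∀ q, Tendsto (fun ξ => genTerm p g f ξ q) l (𝓝 (genTerm p g f η q)) := fun q => by
    have h1 : Tendsto (fun ξ => ∑ k ∈ Finset.Icc 1 (η.1 q.1),
        p q.1 q.2 * g k (η.1 q.1) (η.1 q.2) * (f (jump k q.1 q.2 ξ) - f ξ)) l
        (𝓝 (genTerm p g f η q)) := by
      refine tendsto_finsetSum _ fun k _ => Tendsto.const_mul _ (Tendsto.sub ?_ ?_)
      · refine tendsto_iff_norm_sub_tendsto_zero.2
          (squeeze_zero' (Eventually.of_forall fun _ => norm_nonneg _) ?_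
            (by simpa using hl.const_mul L))
        filter_upwards [hcoord q.1, hcoord q.2] with ξ h1 h2
        have := hf (jump k q.1 q.2 ξ) (jump k q.1 q.2 η)
        rwa [wdist_jump_jump k q.1 q.2 h1 h2] at this
      · exact tendsto_iff_norm_sub_tendsto_zero.2
          (squeeze_zero (fun _ => norm_nonneg _) (fun ξ => hf ξ η)
            (by simpa using hl.const_mul L))
    refine h1.congr' ?_
    filter_upwards [hcoord q.1, hcoord q.2] with ξ h1 h2
    simp only [genTerm, h1, h2]
  let b : Config a → X × X → ℝ := fun ξ q => pairWeight p a q * ((ξ.1 q.1 : ℝ) + (ξ.1 q.2 : ℝ))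
  have hb : ∀ ξ, Summable (b ξ) := summable_pairWeight hp hcol ha
  have hdist := fun ξ : Config a => hK (fun x => |(ξ.1 x : ℝ) - (η.1 x : ℝ)|)
    (fun x => abs_nonneg _) (summable_wdist ha ξ η)
  -- The majorant is linear in the configuration, so passing from `η` to `ξ` changes its tail by a
  -- multiple of the distance, uniformly in `F`.
  have htail : ∀ (F : Finset (X × X)) ξ, ∑' q : {q // q ∉ F}, b ξ q ≤
      ∑' q : {q // q ∉ F}, b η q + K * wdist ξ η := fun F ξ => by
    have hd := hdist ξ
    have h1 : ∑' q : {q // q ∉ F}, b ξ q ≤ ∑' q : {q // q ∉ F}, (b η q +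
        pairWeight p a q * (|(ξ.1 q.1.1 : ℝ) - (η.1 q.1.1 : ℝ)| +
          |(ξ.1 q.1.2 : ℝ) - (η.1 q.1.2 : ℝ)|)) := by
      refine ((hb ξ).subtype _).tsum_le_tsum (fun q => ?_)
        (((hb η).subtype _).add (hd.1.subtype _))
      simp only [b, ← mul_add]
      refine mul_le_mul_of_nonneg_left ?_ (pairWeight_nonneg hp ha _)
      have h1 := le_abs_self ((ξ.1 q.1.1 : ℝ) - (η.1 q.1.1 : ℝ))
      have h2 := le_abs_self ((ξ.1 q.1.2 : ℝ) - (η.1 q.1.2 : ℝ))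
      linarith
    refine h1.trans ?_
    refine (((hb η).subtype (· ∉ F)).tsum_add (hd.1.subtype (· ∉ F))).le.trans ?_
    refine add_le_add le_rfl ((hd.1.tsum_subtype_le _ _ fun q => ?_).trans hd.2)
    exact mul_nonneg (pairWeight_nonneg hp ha _) (add_nonneg (abs_nonneg _) (abs_nonneg _))
  have hgt : ∀ (F : Finset (X × X)) ξ, |∑' q : {q // q ∉ F}, genTerm p g f ξ q| ≤
      L * C * ∑' q : {q // q ∉ F}, b ξ q := fun F ξ => by
    have := tsum_of_norm_bounded (f := fun q : {q // q ∉ F} => genTerm p g f ξ q)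
      ((((hb ξ).subtype (· ∉ F)).mul_left (L * C)).hasSum)
      fun q : {q // q ∉ F} => abs_genTerm_le hp ha hg hC hL hf ξ q
    rw [tsum_mul_left] at this
    exact this
  rw [Metric.tendsto_nhds]
  intro ε hε
  have hLC : 0 < L * C := by positivity
  obtain ⟨F, hF⟩ := ((tendsto_tsum_compl_atTop_zero (b η)).eventually
    (gt_mem_nhds (show 0 < ε / 4 / (L * C) by positivity))).exists
  have hF' : L * C * ∑' q : {q // q ∉ F}, b η q < ε / 4 := by
    rwa [lt_div_iff₀' hLC] at hF
  have h2 := (tendsto_finsetSum F fun q _ => hterm q)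
  have h3 : Tendsto (fun ξ => L * C * (K * wdist ξ η)) l (𝓝 0) := by
    simpa using (hl.const_mul K).const_mul (L * C)
  filter_upwards [(Metric.tendsto_nhds.1 h2) (ε / 4) (by positivity),
    h3.eventually (gt_mem_nhds (show 0 < ε / 4 by positivity))] with ξ h4 h5
  rw [generator_eq_tsum, generator_eq_tsum, Real.dist_eq, ← (hsum ξ).sum_add_tsum_subtype_compl F,
    ← (hsum η).sum_add_tsum_subtype_compl F]
  rw [Real.dist_eq] at h4
  have h6 := (hgt F ξ).trans (mul_le_mul_of_nonneg_left (htail F ξ) hLC.le)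
  have h7 := hgt F η
  rw [mul_add] at h6
  rw [abs_lt] at h4 ⊢
  rw [abs_le] at h6 h7
  constructor <;> linarith [h4.1, h4.2, h6.1, h6.2, h7.1, h7.2]

end Generator

/-! ### Measurability for the product σ-algebra. -/

section Measurability

variable {X : Type*} {p : X → X → ℝ} {g : ℕ → ℕ → ℕ → ℝ} {a : X → ℝ}

theorem measurable_coord (x : X) : Measurable fun η : Config a => η.1 x :=
  (measurable_pi_apply x).comp measurable_subtype_coe

variable [DecidableEq X]

theorem measurable_of_dependsOn {Y : Type*} [MeasurableSpace Y] {F : (X → ℕ) → Y} {Λ : Finset X}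
    (h : DependsOn F (Λ : Set X)) : Measurable F := by
  have : F = (fun ζ : Λ → ℕ => F fun x => if hx : x ∈ Λ then ζ ⟨x, hx⟩ else 0) ∘ Λ.restrict := by
    funext η
    refine h fun x hx => ?_
    simp only [Finset.restrict]
    rw [dif_pos (Finset.mem_coe.1 hx)]
  rw [this]
  exact (Measurable.of_discrete).comp (Finset.measurable_restrict Λ)

/-- The particles of `η` in the finite set `Λ`. -/
def restrictTo (a : X → ℝ) (Λ : Finset X) (η : X → ℕ) : Config a :=
  ⟨fun x => if x ∈ Λ then η x else 0, summable_of_ne_finset_zero (s := Λ) fun x hx => by simp [hx]⟩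

theorem dependsOn_restrictTo {Y : Type*} (f : Config a → Y) (Λ : Finset X) :
    DependsOn (fun η => f (restrictTo a Λ η)) (Λ : Set X) := by
  intro η ζ h
  have : restrictTo a Λ η = restrictTo a Λ ζ := by
    refine Subtype.ext (funext fun x => ?_)
    simp only [restrictTo]
    split_ifs with hx
    · exact h x hx
    · rfl
  simp only [this]

theorem tendsto_wdist_restrictTo (η : Config a) :
    Tendsto (fun Λ => wdist (restrictTo a Λ η.1) η) atTop (𝓝 0) := by
  have h : ∀ Λ : Finset X, wdist (restrictTo a Λ η.1) η =
      wnorm η - ∑ x ∈ Λ, (η.1 x : ℝ) * a x := fun Λ => by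
    have h1 : HasSum (fun x => if x ∈ Λ then (η.1 x : ℝ) * a x else 0)
        (∑ x ∈ Λ, (η.1 x : ℝ) * a x) := by
      have := hasSum_sum_of_ne_finset_zero (s := Λ) (L := .unconditional X)
        (f := fun x => if x ∈ Λ then (η.1 x : ℝ) * a x else 0) (fun x hx => by simp [hx])
      rwa [Finset.sum_congr rfl fun x hx => if_pos hx] at this
    rw [wnorm, ← (η.2.hasSum.sub h1).tsum_eq, wdist]
    refine tsum_congr fun x => ?_
    simp only [restrictTo]
    split_ifs <;> simp
  simp only [h]
  have h2 : Tendsto (fun Λ : Finset X => ∑ x ∈ Λ, (η.1 x : ℝ) * a x) atTop (𝓝 (wnorm η)) :=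
    η.2.hasSum
  simpa using h2.const_sub (wnorm η)

theorem IsLip.tendsto_restrictTo {f : Config a → ℝ} (hf : IsLip f)
    (η : Config a) : Tendsto (fun Λ => f (restrictTo a Λ η.1)) atTop (𝓝 (f η)) := by
  obtain ⟨L, hL, hf⟩ := hf
  exact tendsto_iff_norm_sub_tendsto_zero.2 (squeeze_zero (fun _ => norm_nonneg _)
    (fun Λ => hf _ η) (by simpa using (tendsto_wdist_restrictTo η).const_mul L))

theorem wdist_restrictTo_le (ha : IsWeight p a) (Λ : Finset X) (η ζ : Config a) :
    wdist (restrictTo a Λ η.1) (restrictTo a Λ ζ.1) ≤ wdist η ζ := by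
  refine (summable_wdist ha _ _).tsum_le_tsum (fun x => ?_) (summable_wdist ha _ _)
  simp only [restrictTo]
  split_ifs
  · exact le_rfl
  · simpa using wdist_term_nonneg ha η ζ x

theorem measurable_jumpFun (k : ℕ) (x y : X) : Measurable (jumpFun k x y) := by
  refine measurable_pi_lambda _ fun z => ?_
  have h : (fun η : X → ℕ => jumpFun k x y η z) = fun η : X → ℕ =>
      if k ≤ η x then η z - (if z = x then k else 0) + (if z = y then k else 0) else η z := by
    funext η
    unfold jumpFun
    by_cases h : k ≤ η x <;> simp only [h, if_true, if_false]
  rw [h]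
  refine Measurable.ite ?_ ?_ (measurable_pi_apply z)
  · exact measurable_pi_apply x (measurableSet_Ici (a := k))
  · exact (Measurable.of_discrete (f := fun n : ℕ =>
      n - (if z = x then k else 0) + (if z = y then k else 0))).comp (measurable_pi_apply z)

theorem measurable_jump (k : ℕ) (x y : X) : Measurable (jump k x y : Config a → Config a) :=
  ((measurable_jumpFun k x y).comp measurable_subtype_coe).subtype_mk

/-- The range of summation depends on `η`; treating the two occupation numbers as a separate
countable variable freezes it. -/
theorem measurable_genTerm {f : Config a → ℝ} (hf : Measurable f) (q : X × X) :
    Measurable fun η => genTerm p g f η q := by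
  have h : Measurable fun z : Config a × (ℕ × ℕ) => ∑ k ∈ Finset.Icc 1 z.2.1,
      p q.1 q.2 * g k z.2.1 z.2.2 * (f (jump k q.1 q.2 z.1) - f z.1) :=
    measurable_from_prod_countable_left fun n =>
      Finset.measurable_fun_sum (Finset.Icc 1 n.1) fun k _ =>
        ((hf.comp (measurable_jump k q.1 q.2)).sub hf).const_mul (p q.1 q.2 * g k n.1 n.2)
  exact h.comp (measurable_id.prodMk ((measurable_coord q.1).prodMk (measurable_coord q.2)))

variable [Countable X]

/-- Truncations converge to the configuration in the weighted distance, so `f` is a pointwise limit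
of functions of finitely many coordinates. -/
theorem IsLip.measurable {f : Config a → ℝ} (hf : IsLip f) : Measurable f :=
  measurable_of_tendsto_metrizable' atTop
    (fun Λ => (measurable_of_dependsOn (dependsOn_restrictTo f Λ)).comp measurable_subtype_coe)
    (tendsto_pi_nhds.2 fun η => hf.tendsto_restrictTo η)

theorem measurable_generator (hp : IsTransitionProbability p)
    (hcol : ∀ y, HasSum (fun x => p x y) 1) (ha : IsWeight p a) (hg : IsRate g) {C : ℝ}
    (hC : GrowthBound g C) {f : Config a → ℝ} (hf : IsLip f) : Measurable (generator p g f) :=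
  measurable_of_tendsto_metrizable' atTop
    (fun F => Finset.measurable_fun_sum F fun q _ => measurable_genTerm hf.measurable q)
    (tendsto_pi_nhds.2 fun η => (summable_genTerm hp hcol ha hg hC hf η).hasSum)

end Measurability

end MMP

namespace MMP

open Filter Topology

/-- The standing assumptions on the dynamics: the transition probability is doubly stochastic and
the rates grow linearly. -/
structure Admissible {X : Type*} (p : X → X → ℝ) (g : ℕ → ℕ → ℕ → ℝ) (a : X → ℝ) (C : ℝ) :
    Prop where
  prob : IsTransitionProbability p
  col : ∀ y, HasSum (fun x => p x y) 1
  weight : IsWeight p a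
  rate : IsRate g
  growth : GrowthBound g C

/-! ### From the semigroup to the generator. -/

section Semigroup

variable {X : Type*} [DecidableEq X] {p : X → X → ℝ} {g : ℕ → ℕ → ℕ → ℝ} {a : X → ℝ}
  {C : ℝ} {P : ℝ≥0 → Kernel (Config a) (Config a)} {f : Config a → ℝ}

theorem Admissible.exists_abs_generator_le (hA : Admissible p g a C) (hf : IsLip f) :
    ∃ K : ℝ, 0 < K ∧ ∀ η, |generator p g f η| ≤ K * wnorm η := by
  obtain ⟨K, hK0, hK⟩ :=
    MMP.exists_abs_generator_le hA.prob hA.col hA.weight hA.rate hA.growth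
  obtain ⟨L, hL, hf⟩ := hf
  exact ⟨L * K, mul_pos hL hK0, hK f L hL hf⟩

theorem Admissible.measurable_generator [Countable X] (hA : Admissible p g a C) (hf : IsLip f) :
    Measurable (generator p g f) :=
  MMP.measurable_generator hA.prob hA.col hA.weight hA.rate hA.growth hf

theorem act_zero (hP : IsProcess p g P) (hf : Measurable f) (η : Config a) : act P 0 f η = f η := by
  rw [act, hP.zero, Kernel.id_apply, integral_dirac' _ _ hf.stronglyMeasurable]

theorem act_add (hP : IsProcess p g P) (hf : IsLip f) (s t : ℝ≥0) :
    act P (s + t) f = act P s (act P t f) := by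
  funext η
  have h := hP.integrable f hf (s + t) η
  simp only [act]
  rw [hP.add] at h ⊢
  exact Kernel.integral_comp h

theorem act_continuousOn (hP : IsProcess p g P) (hf : IsLip f) (η : Config a) (T : ℝ≥0) :
    ContinuousOn (fun t : ℝ => act P t.toNNReal f η) (Set.Icc 0 T) := by
  have h1 : ContinuousOn (fun t : ℝ => f η +
      ∫ s in (0 : ℝ)..t, act P s.toNNReal (generator p g f) η) (Set.Icc 0 T) := by
    refine continuousOn_const.add ?_
    have := intervalIntegral.continuousOn_primitive_interval' (hP.dynkin f hf T η).1
      (Set.left_mem_uIcc)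
    rwa [Set.uIcc_of_le T.coe_nonneg] at this
  refine h1.congr fun t ht => ?_
  have := (hP.dynkin f hf t.toNNReal η).2
  rwa [Real.coe_toNNReal _ ht.1] at this

theorem tendsto_act_nhdsGE_zero [Countable X] (hP : IsProcess p g P) (hf : IsLip f)
    (η : Config a) :
    Tendsto (fun t : ℝ => act P t.toNNReal f η) (𝓝[≥] 0) (𝓝 (f η)) := by
  have h := (act_continuousOn hP hf η 1) 0 (by simp)
  rw [ContinuousWithinAt, Real.toNNReal_zero, act_zero hP hf.measurable,
    nhdsWithin_Icc_eq_nhdsGE (by simp)] at h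
  exact h

theorem integrable_generator [Countable X] (hA : Admissible p g a C) (hf : IsLip f) {κ : Measure (Config a)}
    (hκ : Integrable wnorm κ) : Integrable (generator p g f) κ := by
  obtain ⟨K, -, hK⟩ := hA.exists_abs_generator_le hf
  exact (hκ.const_mul K).mono' (hA.measurable_generator hf).aestronglyMeasurable
    (Eventually.of_forall hK)

theorem IsProcess.integrable_wnorm (hA : Admissible p g a C) (hP : IsProcess p g P) (t : ℝ≥0)
    (η : Config a) : Integrable wnorm (P t η) :=
  hP.integrable _ (isLip_wnorm hA.weight) t η

theorem abs_act_generator_le [Countable X] (hA : Admissible p g a C) (hP : IsProcess p g P) {K : ℝ}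
    (hK : ∀ η, |generator p g f η| ≤ K * wnorm η) (t : ℝ≥0) (η : Config a) :
    |act P t (generator p g f) η| ≤ K * act P t wnorm η := by
  rw [act, act, ← integral_const_mul, ← Real.norm_eq_abs]
  exact norm_integral_le_of_norm_le ((hP.integrable_wnorm hA t η).const_mul K)
    (Eventually.of_forall hK)

/-- A substitute for Grönwall's inequality. At a maximum `r` of the mean norm on `[0, 1/(2K)]`,
Dynkin's formula bounds the maximum by `‖η‖` plus at most half of itself. -/
theorem exists_act_wnorm_le [Countable X] (hA : Admissible p g a C) (hP : IsProcess p g P) :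
    ∃ δ : ℝ, 0 < δ ∧ ∀ s ∈ Set.Icc 0 δ, ∀ η, act P s.toNNReal wnorm η ≤ 2 * wnorm η := by
  have hN := isLip_wnorm (a := a) hA.weight
  obtain ⟨K, hK0, hK⟩ := hA.exists_abs_generator_le hN
  refine ⟨1 / (2 * K), by positivity, fun s hs η => ?_⟩
  have hδ : (0 : ℝ) ≤ 1 / (2 * K) := by positivity
  obtain ⟨r, hr, hmax⟩ := isCompact_Icc.exists_isMaxOn (Set.nonempty_Icc.2 hδ)
    (by
      have := act_continuousOn hP hN η (Real.toNNReal (1 / (2 * K)))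
      rwa [Real.coe_toNNReal _ hδ] at this)
  set n : ℝ → ℝ := fun t => act P t.toNNReal wnorm η
  have hn : n r = wnorm η + ∫ u in (0 : ℝ)..r, act P u.toNNReal (generator p g wnorm) η := by
    have := (hP.dynkin _ hN r.toNNReal η).2
    rwa [Real.coe_toNNReal _ hr.1] at this
  have hint : |∫ u in (0 : ℝ)..r, act P u.toNNReal (generator p g wnorm) η| ≤
      K * n r * |r - 0| := by
    rw [← Real.norm_eq_abs]
    refine intervalIntegral.norm_integral_le_of_norm_le_const fun u hu => ?_
    rw [Set.uIoc_of_le hr.1] at hu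
    exact (abs_act_generator_le hA hP hK _ η).trans
      (mul_le_mul_of_nonneg_left (hmax ⟨hu.1.le, hu.2.trans hr.2⟩) hK0.le)
  have hn0 : 0 ≤ n r := integral_nonneg (wnorm_nonneg hA.weight)
  have hKr : K * r ≤ 1 / 2 := by
    have := mul_le_mul_of_nonneg_left hr.2 hK0.le
    rwa [show K * (1 / (2 * K)) = 1 / 2 by field_simp] at this
  rw [sub_zero, abs_of_nonneg hr.1] at hint
  have h1 := (abs_le.1 hint).2
  have h2 : n s ≤ n r := hmax hs
  nlinarith

/-- The function `𝓛 f` need not be Lipschitz, but continuity at `η` and linear growth bound its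
increment by `ε / 2` plus a multiple of the distance to `η`. That distance is Lipschitz, so its mean
tends to zero. -/
theorem tendsto_act_generator [Countable X] (hA : Admissible p g a C) (hP : IsProcess p g P) (hf : IsLip f)
    (η : Config a) : Tendsto (fun t : ℝ => act P t.toNNReal (generator p g f) η) (𝓝[≥] 0)
      (𝓝 (generator p g f η)) := by
  obtain ⟨K, hK0, hK⟩ := hA.exists_abs_generator_le hf
  have hcont := tendsto_generator hA.prob hA.col hA.weight hA.rate hA.growth hf η
  have hw := isLip_wdist hA.weight η
  have hzero := tendsto_act_nhdsGE_zero hP hw η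
  rw [wdist_self] at hzero
  rw [Metric.tendsto_nhds]
  intro ε hε
  obtain ⟨t, ht, hball⟩ := mem_comap.1 (Metric.tendsto_nhds.1 hcont (ε / 2) (by positivity))
  obtain ⟨δ, hδ, hδt⟩ := Metric.mem_nhds_iff.1 ht
  have hclose : ∀ ξ, wdist ξ η < δ → |generator p g f ξ - generator p g f η| < ε / 2 :=
    fun ξ hξ => hball (hδt (by
      rw [Metric.mem_ball, Real.dist_eq, sub_zero, abs_of_nonneg (wdist_nonneg hA.weight _ _)]
      exact hξ))
  -- At distance at least `δ` the increment is at most `2K‖η‖` plus `K` times the distance, and the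
  -- first term is absorbed by dividing by `δ`.
  set c : ℝ := 2 * K * wnorm η / δ + K
  have hη := wnorm_nonneg hA.weight η
  have hmod : ∀ ξ, |generator p g f ξ - generator p g f η| ≤ ε / 2 + c * wdist ξ η := fun ξ => by
    have hd := wdist_nonneg hA.weight ξ η
    rcases lt_or_ge (wdist ξ η) δ with h | h
    · have : 0 ≤ c * wdist ξ η := by positivity
      linarith [hclose ξ h]
    · have h1 := (abs_sub (generator p g f ξ) (generator p g f η)).trans
        (add_le_add (hK ξ) (hK η))
      have h2 := (abs_le.1 (abs_wnorm_sub_le hA.weight ξ η)).2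
      have h3 : 2 * K * wnorm η ≤ 2 * K * wnorm η / δ * wdist ξ η := by
        rw [div_mul_eq_mul_div, le_div_iff₀ hδ]
        exact mul_le_mul_of_nonneg_left h (by positivity)
      simp only [c]
      nlinarith
  have hlim : Tendsto (fun t : ℝ => c * act P t.toNNReal (fun ξ => wdist ξ η) η) (𝓝[≥] 0) (𝓝 0) := by
    simpa using hzero.const_mul c
  filter_upwards [hlim.eventually (gt_mem_nhds (show 0 < ε / 2 by positivity))] with t ht
  have := hP.markov t.toNNReal
  have hI := integrable_generator hA hf (hP.integrable_wnorm hA t.toNNReal η)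
  have h1 : act P t.toNNReal (generator p g f) η - generator p g f η =
      ∫ ξ, (generator p g f ξ - generator p g f η) ∂(P t.toNNReal η) := by
    rw [integral_sub hI (integrable_const _)]
    simp [act]
  have h2 : ‖∫ ξ, (generator p g f ξ - generator p g f η) ∂(P t.toNNReal η)‖ ≤
      ∫ ξ, (ε / 2 + c * wdist ξ η) ∂(P t.toNNReal η) :=
    norm_integral_le_of_norm_le ((integrable_const _).add ((hP.integrable _ hw _ η).const_mul c))
      (Eventually.of_forall hmod)
  rw [integral_add (integrable_const _) ((hP.integrable _ hw _ η).const_mul c),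
    integral_const_mul] at h2
  simp only [integral_const, probReal_univ, one_smul] at h2
  rw [Real.dist_eq, h1]
  simp only [act] at ht
  rw [Real.norm_eq_abs] at h2
  linarith

theorem tendsto_act_sub_div [Countable X] (hA : Admissible p g a C) (hP : IsProcess p g P) (hf : IsLip f)
    (η : Config a) : Tendsto (fun h : ℝ => (act P h.toNNReal f η - f η) / h) (𝓝[>] 0)
      (𝓝 (generator p g f η)) := by
  have hφ := tendsto_act_generator hA hP hf η
  have hI := (hP.dynkin f hf 1 η).1
  rw [NNReal.coe_one] at hI
  have h0 : act P (0 : ℝ).toNNReal (generator p g f) η = generator p g f η := by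
    rw [Real.toNNReal_zero, act_zero hP (hA.measurable_generator hf)]
  have hsm : StronglyMeasurableAtFilter (fun s : ℝ => act P s.toNNReal (generator p g f) η)
      (𝓝[>] 0) :=
    ⟨Set.Ioc 0 1, Ioc_mem_nhdsGT one_pos, hI.1.aestronglyMeasurable⟩
  have hd := intervalIntegral.integral_hasDerivWithinAt_right
    (f := fun s : ℝ => act P s.toNNReal (generator p g f) η) (a := 0) (b := 0) (s := Set.Ici 0)
    (t := Set.Ioi 0) IntervalIntegrable.refl hsm (by
      rw [ContinuousWithinAt, h0]
      exact hφ.mono_left (nhdsWithin_mono _ Set.Ioi_subset_Ici_self))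
  rw [h0, ← hasDerivWithinAt_Ioi_iff_Ici, hasDerivWithinAt_iff_tendsto_slope' (by simp)] at hd
  refine hd.congr' ?_
  filter_upwards [self_mem_nhdsWithin] with h hh
  have hh0 : (0 : ℝ) ≤ h := le_of_lt hh
  have := (hP.dynkin f hf h.toNNReal η).2
  rw [Real.coe_toNNReal _ hh0] at this
  rw [slope_def_field, this]
  simp

theorem abs_act_sub_div_le [Countable X] (hA : Admissible p g a C) (hP : IsProcess p g P)
    (hf : IsLip f) {K : ℝ}
    (hK0 : 0 < K) (hK : ∀ η, |generator p g f η| ≤ K * wnorm η) {δ : ℝ}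
    (hδ : ∀ s ∈ Set.Icc 0 δ, ∀ η, act P s.toNNReal wnorm η ≤ 2 * wnorm η) {h : ℝ}
    (hh : h ∈ Set.Ioc 0 δ) (η : Config a) :
    |(act P h.toNNReal f η - f η) / h| ≤ K * (2 * wnorm η) := by
  have hd := (hP.dynkin f hf h.toNNReal η).2
  rw [Real.coe_toNNReal _ hh.1.le] at hd
  rw [hd, add_sub_cancel_left, abs_div, abs_of_pos hh.1, div_le_iff₀ hh.1]
  have hint : |∫ u in (0 : ℝ)..h, act P u.toNNReal (generator p g f) η| ≤
      K * (2 * wnorm η) * |h - 0| := by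
    rw [← Real.norm_eq_abs]
    refine intervalIntegral.norm_integral_le_of_norm_le_const fun u hu => ?_
    rw [Set.uIoc_of_le hh.1.le] at hu
    exact (abs_act_generator_le hA hP hK _ η).trans
      (mul_le_mul_of_nonneg_left (hδ _ ⟨hu.1.le, hu.2.trans hh.2⟩ η) hK0.le)
  rwa [sub_zero, abs_of_pos hh.1] at hint

theorem IsLip.integrable [Countable X] (hA : Admissible p g a C) (hf : IsLip f) {κ : Measure (Config a)}
    [IsFiniteMeasure κ] (hκ : Integrable wnorm κ) : Integrable f κ := by
  obtain ⟨L, -, hL⟩ := hf.abs_le hA.weight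
  exact ((integrable_const _).add (hκ.const_mul L)).mono'
    hf.measurable.aestronglyMeasurable (Eventually.of_forall hL)

theorem tendsto_integral_act_sub_div [Countable X] (hA : Admissible p g a C) (hP : IsProcess p g P)
    (hf : IsLip f) {κ : Measure (Config a)} [IsFiniteMeasure κ] (hκ : Integrable wnorm κ) :
    Tendsto (fun h : ℝ => (∫ η, act P h.toNNReal f η ∂κ - ∫ η, f η ∂κ) / h) (𝓝[>] 0)
      (𝓝 (∫ η, generator p g f η ∂κ)) := by
  obtain ⟨K, hK0, hK⟩ := hA.exists_abs_generator_le hf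
  obtain ⟨δ, hδ0, hδ⟩ := exists_act_wnorm_le hA hP
  have hlim : Tendsto (fun h : ℝ => ∫ η, (act P h.toNNReal f η - f η) / h ∂κ) (𝓝[>] 0)
      (𝓝 (∫ η, generator p g f η ∂κ)) := by
    refine tendsto_integral_filter_of_dominated_convergence (fun η => K * (2 * wnorm η))
      (Eventually.of_forall fun h => ?_) ?_ ((hκ.const_mul 2).const_mul K)
      (Eventually.of_forall fun η => tendsto_act_sub_div hA hP hf η)
    · exact ((((hP.isLip f hf _).measurable).sub
        hf.measurable).div_const h).aestronglyMeasurable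
    · filter_upwards [Ioc_mem_nhdsGT hδ0] with h hh
      exact Eventually.of_forall fun η => abs_act_sub_div_le hA hP hf hK0 hK hδ hh η
  refine hlim.congr fun h => ?_
  rw [integral_div, integral_sub ((hP.isLip f hf _).integrable hA hκ) (hf.integrable hA hκ)]

theorem abs_act_le (hP : IsProcess p g P) {B : ℝ} (hB : ∀ η, |f η| ≤ B) (t : ℝ≥0) (η : Config a) :
    |act P t f η| ≤ B := by
  have := hP.markov t
  have h := norm_integral_le_of_norm_le_const (μ := P t η) (f := f) (Eventually.of_forall hB)
  simpa [act] using h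

/-- A measure with a finite first moment is preserved by the semigroup if and only if the
generator has mean zero on bounded Lipschitz functions. -/
theorem integral_act_eq_iff [Countable X] (hA : Admissible p g a C) (hP : IsProcess p g P)
    {κ : Measure (Config a)} [IsFiniteMeasure κ] (hκ : Integrable wnorm κ) :
    (∀ f : Config a → ℝ, IsLip f → (∃ B : ℝ, ∀ η, |f η| ≤ B) → ∀ t : ℝ≥0,
      ∫ η, act P t f η ∂κ = ∫ η, f η ∂κ) ↔
    ∀ f : Config a → ℝ, IsLip f → (∃ B : ℝ, ∀ η, |f η| ≤ B) → ∫ η, generator p g f η ∂κ = 0 := by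
  refine ⟨fun h f hf hB => ?_, fun h f hf hB t => ?_⟩
  · have h1 := tendsto_integral_act_sub_div hA hP hf hκ
    simp only [h f hf hB, sub_self, zero_div] at h1
    exact tendsto_nhds_unique h1 tendsto_const_nhds
  · obtain ⟨B, hB⟩ := hB
    set F : ℝ → ℝ := fun t => ∫ η, act P t.toNNReal f η ∂κ
    have hcont : ContinuousOn F (Set.Icc 0 t) := by
      refine continuousOn_of_dominated (bound := fun _ => B)
        (fun s _ => ((hP.isLip f hf _).measurable).aestronglyMeasurable)
        (fun s _ => Eventually.of_forall (abs_act_le hP hB _)) (integrable_const _)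
        (Eventually.of_forall fun η => act_continuousOn hP hf η t)
    -- By the semigroup law this is the derivative at time zero for the function `S(x)f`, again
    -- bounded and Lipschitz, to which the hypothesis applies.
    have hderiv : ∀ x ∈ Set.Ico (0 : ℝ) t, HasDerivWithinAt F 0 (Set.Ici x) x := fun x hx => by
      rw [← hasDerivWithinAt_Ioi_iff_Ici, hasDerivWithinAt_iff_tendsto_slope' (by simp)]
      have h1 := tendsto_integral_act_sub_div hA hP (hP.isLip f hf x.toNNReal) hκ
      rw [h _ (hP.isLip f hf x.toNNReal) ⟨B, abs_act_le hP hB _⟩] at h1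
      have h2 : Tendsto (fun y : ℝ => y - x) (𝓝[>] x) (𝓝[>] 0) := by
        refine tendsto_nhdsWithin_iff.2 ⟨?_, ?_⟩
        · have : Tendsto (fun y : ℝ => y - x) (𝓝 x) (𝓝 (x - x)) :=
            (continuous_id.sub continuous_const).tendsto x
          rw [sub_self] at this
          exact this.mono_left nhdsWithin_le_nhds
        · filter_upwards [self_mem_nhdsWithin] with y hy
          exact sub_pos.2 (Set.mem_Ioi.1 hy)
      refine (h1.comp h2).congr' ?_
      filter_upwards [self_mem_nhdsWithin] with y hy
      have hxy : x < y := hy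
      have h3 : y.toNNReal = (y - x).toNNReal + x.toNNReal := by
        rw [← Real.toNNReal_add (sub_nonneg.2 hxy.le) hx.1, sub_add_cancel]
      simp only [Function.comp, slope_def_field, F]
      rw [h3, act_add hP hf]
    have := constant_of_has_deriv_right_zero hcont hderiv t ⟨t.coe_nonneg, le_rfl⟩
    simp only [F, Real.toNNReal_coe, Real.toNNReal_zero] at this
    rw [this]
    exact integral_congr_ae (Eventually.of_forall (act_zero hP hf.measurable))

end Semigroup

end MMP

namespace MMP

open Filter Topology

/-! ### Gain and loss of mass at a pair of occupation numbers. -/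

section Flux

/-- A probability on `ℕ` with finite mean, given by its masses. -/
structure IsMarginal (m : ℕ → ℝ) : Prop where
  nonneg : ∀ n, 0 ≤ m n
  hasSum : HasSum m 1
  summable : Summable fun n : ℕ => (n : ℝ) * m n

/-- The mass that flows into a pair of occupation numbers per unit of time. -/
noncomputable def gain (g : ℕ → ℕ → ℕ → ℝ) (m : ℕ → ℝ) (q : ℕ × ℕ) : ℝ :=
  ∑ k ∈ Finset.range (q.2 + 1), g k (q.1 + k) (q.2 - k) * m (q.1 + k) * m (q.2 - k)

/-- The net mass that flows into a pair of occupation numbers per unit of time. -/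
noncomputable def flux (g : ℕ → ℕ → ℕ → ℝ) (m : ℕ → ℝ) (q : ℕ × ℕ) : ℝ :=
  gain g m q - m q.1 * m q.2 * ∑ k ∈ Finset.range (q.1 + 1), g k q.1 q.2

variable {g : ℕ → ℕ → ℕ → ℝ} {m : ℕ → ℝ} {C : ℝ}

theorem IsRate.sum_range_eq (hg : IsRate g) (α β : ℕ) (F : ℕ → ℝ) :
    ∑ k ∈ Finset.range (α + 1), g k α β * F k = ∑ k ∈ Finset.Icc 1 α, g k α β * F k := by
  symm
  refine Finset.sum_subset (fun k hk => ?_) fun k hk hk' => ?_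
  · simp only [Finset.mem_Icc, Finset.mem_range] at hk ⊢
    omega
  · simp only [Finset.mem_Icc, Finset.mem_range] at hk hk'
    obtain rfl : k = 0 := by omega
    rw [hg.zero, zero_mul]

theorem IsRate.sum_range_le (hg : IsRate g) (hC : GrowthBound g C) (α β : ℕ) :
    ∑ k ∈ Finset.range (α + 1), g k α β ≤ C * ((α : ℝ) + (β : ℝ)) := by
  have h := hg.sum_range_eq α β fun _ => 1
  simp only [mul_one] at h
  exact h ▸ hC.sum_le hg α β

theorem IsMarginal.summable_pair (hm : IsMarginal m) :
    Summable fun q : ℕ × ℕ => m q.1 * m q.2 * ((q.1 : ℝ) + (q.2 : ℝ)) := by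
  have h1 : Summable fun q : ℕ × ℕ => ((q.1 : ℝ) * m q.1) * m q.2 :=
    hm.summable.mul_of_nonneg hm.hasSum.summable
      (fun n => mul_nonneg n.cast_nonneg (hm.nonneg n)) hm.nonneg
  have h2 : Summable fun q : ℕ × ℕ => m q.1 * ((q.2 : ℝ) * m q.2) :=
    hm.hasSum.summable.mul_of_nonneg hm.summable hm.nonneg
      (fun n => mul_nonneg n.cast_nonneg (hm.nonneg n))
  refine (h1.add h2).congr fun q => ?_
  ring

theorem IsMarginal.summable_rate (hm : IsMarginal m) (hg : IsRate g) (hC : GrowthBound g C) :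
    Summable fun q : ℕ × ℕ => m q.1 * m q.2 * ∑ k ∈ Finset.range (q.1 + 1), g k q.1 q.2 := by
  refine Summable.of_nonneg_of_le (fun q => ?_) (fun q => ?_) (hm.summable_pair.mul_left C)
  · exact mul_nonneg (mul_nonneg (hm.nonneg _) (hm.nonneg _))
      (Finset.sum_nonneg fun k _ => hg.nonneg _ _ _)
  · rw [mul_left_comm]
    exact mul_le_mul_of_nonneg_left (hg.sum_range_le hC _ _)
      (mul_nonneg (hm.nonneg _) (hm.nonneg _))

theorem IsMarginal.summable_jumps (hm : IsMarginal m) (hg : IsRate g) (hC : GrowthBound g C) :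
    Summable fun z : (ℕ × ℕ) × ℕ => m z.1.1 * m z.1.2 * g z.2 z.1.1 z.1.2 := by
  have hin : ∀ q : ℕ × ℕ, HasSum (fun k => m q.1 * m q.2 * g k q.1 q.2)
      (m q.1 * m q.2 * ∑ k ∈ Finset.range (q.1 + 1), g k q.1 q.2) := fun q => by
    refine HasSum.mul_left _ (hasSum_sum_of_ne_finset_zero fun k hk => hg.eq_zero_of_lt _ _ _ ?_)
    simpa using hk
  refine (summable_prod_of_nonneg fun z => mul_nonneg (mul_nonneg (hm.nonneg _) (hm.nonneg _))
    (hg.nonneg _ _ _)).2 ⟨fun q => (hin q).summable, ?_⟩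
  simpa only [(hin _).tsum_eq] using hm.summable_rate hg hC

/-- The change of variables that sends a pair of occupation numbers to its value after a jump. -/
theorem IsMarginal.exists_hasSum_gain (hm : IsMarginal m) (hg : IsRate g) (hC : GrowthBound g C)
    {F : ℕ × ℕ → ℝ} {B : ℝ} (hF : ∀ q, |F q| ≤ B) :
    ∃ S, HasSum (fun q => gain g m q * F q) S ∧
      HasSum (fun q : ℕ × ℕ => m q.1 * m q.2 *
        ∑ k ∈ Finset.range (q.1 + 1), g k q.1 q.2 * F (q.1 - k, q.2 + k)) S := by
  let s : (ℕ × ℕ) × ℕ → ℝ := fun z =>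
    m z.1.1 * m z.1.2 * g z.2 z.1.1 z.1.2 * F (z.1.1 - z.2, z.1.2 + z.2)
  let t : (ℕ × ℕ) × ℕ → ℝ := fun z => if z.2 ≤ z.1.2 then
    g z.2 (z.1.1 + z.2) (z.1.2 - z.2) * m (z.1.1 + z.2) * m (z.1.2 - z.2) * F z.1 else 0
  have hs : Summable s := by
    refine Summable.of_norm_bounded ((hm.summable_jumps hg hC).mul_right B) fun z => ?_
    have h0 := mul_nonneg (mul_nonneg (hm.nonneg z.1.1) (hm.nonneg z.1.2))
      (hg.nonneg z.2 z.1.1 z.1.2)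
    rw [Real.norm_eq_abs, abs_mul, abs_of_nonneg h0]
    exact mul_le_mul_of_nonneg_left (hF _) h0
  -- A jump of `k` particles leads from `(i + k, j)` to `(i, j + k)`. Parametrizing by `(i, j, k)`
  -- avoids truncated subtraction: `e₁` gives the state before the jump and `e₂` the state after it.
  let e₁ : (ℕ × ℕ) × ℕ → (ℕ × ℕ) × ℕ := fun z => ((z.1.1 + z.2, z.1.2), z.2)
  let e₂ : (ℕ × ℕ) × ℕ → (ℕ × ℕ) × ℕ := fun z => ((z.1.1, z.1.2 + z.2), z.2)
  have he₁ : Function.Injective e₁ := by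
    rintro ⟨⟨i, j⟩, k⟩ ⟨⟨i', j'⟩, k'⟩ h
    simp only [e₁, Prod.mk.injEq] at h ⊢
    omega
  have he₂ : Function.Injective e₂ := by
    rintro ⟨⟨i, j⟩, k⟩ ⟨⟨i', j'⟩, k'⟩ h
    simp only [e₂, Prod.mk.injEq] at h ⊢
    omega
  have hs₀ : ∀ z ∉ Set.range e₁, s z = 0 := by
    rintro ⟨⟨α, β⟩, k⟩ hz
    have : α < k := by
      by_contra h
      exact hz ⟨((α - k, β), k), Prod.ext (Prod.ext (Nat.sub_add_cancel (not_lt.1 h)) rfl) rfl⟩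
    simp [s, hg.eq_zero_of_lt _ _ _ this]
  have ht₀ : ∀ z ∉ Set.range e₂, t z = 0 := by
    rintro ⟨⟨α, β⟩, k⟩ hz
    exact if_neg fun h => hz
      ⟨((α, β - k), k), Prod.ext (Prod.ext rfl (Nat.sub_add_cancel h)) rfl⟩
  have hst : s ∘ e₁ = t ∘ e₂ := by
    funext ⟨⟨i, j⟩, k⟩
    simp only [s, t, e₁, e₂, Function.comp, Nat.add_sub_cancel, Nat.le_add_left, if_true]
    ring
  have h1 := hs.hasSum
  have h2 : HasSum t (∑' z, s z) := by
    rwa [← he₂.hasSum_iff ht₀, ← hst, he₁.hasSum_iff hs₀]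
  refine ⟨∑' z, s z, h2.prod_fiberwise fun q => ?_, h1.prod_fiberwise fun q => ?_⟩
  · have h : gain g m q * F q = ∑ k ∈ Finset.range (q.2 + 1), t (q, k) := by
      rw [gain, Finset.sum_mul]
      refine Finset.sum_congr rfl fun k hk => ?_
      have : k ≤ q.2 := by
        have := Finset.mem_range.1 hk
        omega
      simp [t, this]
    rw [h]
    refine hasSum_sum_of_ne_finset_zero fun k hk => if_neg fun h => hk ?_
    simp only [Finset.mem_range] at h ⊢
    omega
  · have h : m q.1 * m q.2 * ∑ k ∈ Finset.range (q.1 + 1), g k q.1 q.2 * F (q.1 - k, q.2 + k) =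
        ∑ k ∈ Finset.range (q.1 + 1), s (q, k) := by
      rw [Finset.mul_sum]
      exact Finset.sum_congr rfl fun k _ => by simp only [s]; ring
    rw [h]
    refine hasSum_sum_of_ne_finset_zero fun k hk => ?_
    have : q.1 < k := by simpa using hk
    simp [s, hg.eq_zero_of_lt _ _ _ this]

/-- This is the adjoint relation for the two-site dynamics. Boundedness of `F` and the finite mean
make gain and loss separately summable. -/
theorem IsMarginal.exists_hasSum_flux (hm : IsMarginal m) (hg : IsRate g) (hC : GrowthBound g C)
    {F : ℕ × ℕ → ℝ} {B : ℝ} (hF : ∀ q, |F q| ≤ B) :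
    ∃ S, HasSum (fun q => flux g m q * F q) S ∧
      HasSum (fun q : ℕ × ℕ => m q.1 * m q.2 *
        ∑ k ∈ Finset.range (q.1 + 1), g k q.1 q.2 * (F (q.1 - k, q.2 + k) - F q)) S := by
  obtain ⟨S, h1, h2⟩ := hm.exists_hasSum_gain hg hC hF
  have h3 : Summable fun q : ℕ × ℕ =>
      m q.1 * m q.2 * (∑ k ∈ Finset.range (q.1 + 1), g k q.1 q.2) * F q := by
    refine Summable.of_norm_bounded ((hm.summable_rate hg hC).mul_right B) fun q => ?_
    have h0 : 0 ≤ m q.1 * m q.2 * (∑ k ∈ Finset.range (q.1 + 1), g k q.1 q.2) :=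
      mul_nonneg (mul_nonneg (hm.nonneg _) (hm.nonneg _))
        (Finset.sum_nonneg fun k _ => hg.nonneg _ _ _)
    rw [Real.norm_eq_abs, abs_mul, abs_of_nonneg h0]
    exact mul_le_mul_of_nonneg_left (hF _) h0
  refine ⟨S - ∑' q : ℕ × ℕ, m q.1 * m q.2 *
    (∑ k ∈ Finset.range (q.1 + 1), g k q.1 q.2) * F q, ?_, ?_⟩
  · refine (h1.sub h3.hasSum).congr_fun fun q => ?_
    simp only [flux]; ring
  · refine (h2.sub h3.hasSum).congr_fun fun q => ?_
    simp only [mul_sub, Finset.sum_sub_distrib, ← Finset.sum_mul]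
    ring

theorem IsMarginal.summable_flux_mul (hm : IsMarginal m) (hg : IsRate g) (hC : GrowthBound g C)
    {F : ℕ × ℕ → ℝ} {B : ℝ} (hF : ∀ q, |F q| ≤ B) : Summable fun q => flux g m q * F q := by
  obtain ⟨S, h, -⟩ := hm.exists_hasSum_flux hg hC hF
  exact h.summable

theorem IsMarginal.tsum_flux (hm : IsMarginal m) (hg : IsRate g) (hC : GrowthBound g C) :
    ∑' q, flux g m q = 0 := by
  obtain ⟨S, h1, h2⟩ := hm.exists_hasSum_flux hg hC (F := fun _ => 1) (B := 1) (by simp)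
  simp only [mul_one, sub_self, mul_zero, Finset.sum_const_zero] at h1 h2
  rw [h1.tsum_eq, h2.unique hasSum_zero]

theorem gain_nonneg (hm : IsMarginal m) (hg : IsRate g) (q : ℕ × ℕ) : 0 ≤ gain g m q :=
  Finset.sum_nonneg fun _ _ => mul_nonneg (mul_nonneg (hg.nonneg _ _ _) (hm.nonneg _)) (hm.nonneg _)

/-- Off the support the gain vanishes by hypothesis and the loss carries the factor `m α * m β`,
matching the value zero chosen for `A`. -/
theorem SupportCondition.flux_eq (h : SupportCondition g m) (α β : ℕ) :
    flux g m (α, β) = m α * m β * A g m α β := by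
  by_cases h0 : m α * m β = 0
  · have := h α β h0
    simp only [flux, gain, this, h0, zero_mul, sub_self]
  · rw [A, if_pos h0, flux, gain, mul_sub]
    refine congrArg₂ _ ?_ rfl
    rw [Finset.mul_sum]
    refine Finset.sum_congr rfl fun k _ => ?_
    have h1 := left_ne_zero_of_mul h0
    have h2 := right_ne_zero_of_mul h0
    field_simp

end Flux

/-! ### Conditioning the product measure on one or two sites. -/

section Product

theorem hasSum_integral_countable {Ω : Type*} [MeasurableSpace Ω] [Countable Ω]
    [MeasurableSingletonClass Ω] {μ : Measure Ω} {f : Ω → ℝ} (hf : Integrable f μ) :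
    HasSum (fun x => μ.real {x} * f x) (∫ x, f x ∂μ) := by
  have hf' := hf
  rw [← Measure.sum_smul_dirac μ] at hf'
  have h := hasSum_integral_measure hf'
  rw [Measure.sum_smul_dirac μ] at h
  simpa [integral_smul_measure, measureReal_def] using h

theorem isMarginal_measureReal {μ : Measure ℕ} [IsProbabilityMeasure μ]
    (hμ : Integrable (fun n : ℕ => (n : ℝ)) μ) : IsMarginal fun n => μ.real {n} where
  nonneg _ := measureReal_nonneg
  hasSum := by simpa using hasSum_integral_countable (integrable_const (μ := μ) (1 : ℝ))
  summable := by simpa only [mul_comm] using (hasSum_integral_countable hμ).summable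

variable {X : Type*} [DecidableEq X] {g : ℕ → ℕ → ℕ → ℝ} {C : ℝ} (μ : Measure ℕ)
  [IsProbabilityMeasure μ]

/-- Resampling one coordinate independently preserves the product measure; this replaces conditional
expectations throughout. -/
theorem measurePreserving_update (x : X) :
    MeasurePreserving (fun q : ℕ × (X → ℕ) => Function.update q.2 x q.1)
      (μ.prod (Measure.infinitePi fun _ : X => μ)) (Measure.infinitePi fun _ : X => μ) := by
  have hmeas : Measurable fun q : ℕ × (X → ℕ) => Function.update q.2 x q.1 :=
    measurable_update'.comp measurable_swap
  refine ⟨hmeas, Measure.eq_infinitePi _ fun s t ht => ?_⟩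
  rw [Measure.map_apply hmeas (MeasurableSet.pi s.countable_toSet fun i _ => ht i)]
  by_cases hx : x ∈ s
  · have : (fun q : ℕ × (X → ℕ) => Function.update q.2 x q.1) ⁻¹' Set.pi s t =
        t x ×ˢ Set.pi (s.erase x : Finset X) t := by
      ext ⟨n, η⟩
      simp only [Set.mem_preimage, Set.mem_pi, Set.mem_prod, Finset.mem_coe, Finset.mem_erase]
      constructor
      · intro h
        refine ⟨by simpa using h x hx, fun i hi => ?_⟩
        simpa [hi.1] using h i hi.2
      · rintro ⟨h1, h2⟩ i hi
        by_cases hix : i = x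
        · subst hix; simpa using h1
        · simpa [hix] using h2 i ⟨hix, hi⟩
    rw [this, Measure.prod_prod, Measure.infinitePi_pi _ fun i _ => ht i,
      Finset.mul_prod_erase _ (fun i => μ (t i)) hx]
  · have : (fun q : ℕ × (X → ℕ) => Function.update q.2 x q.1) ⁻¹' Set.pi s t =
        Set.univ ×ˢ Set.pi s t := by
      ext ⟨n, η⟩
      simp only [Set.mem_preimage, Set.mem_pi, Set.mem_prod, Finset.mem_coe, Set.mem_univ, true_and]
      refine forall₂_congr fun i hi => ?_
      have : i ≠ x := fun h => hx (h ▸ hi)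
      simp [this]
    rw [this, Measure.prod_prod, Measure.infinitePi_pi _ fun i _ => ht i, measure_univ, one_mul]

theorem measurePreserving_update_update (u v : X) :
    MeasurePreserving (fun q : (ℕ × ℕ) × (X → ℕ) =>
      Function.update (Function.update q.2 u q.1.1) v q.1.2)
      ((μ.prod μ).prod (Measure.infinitePi fun _ : X => μ)) (Measure.infinitePi fun _ : X => μ) := by
  have h1 := measurePreserving_update μ u
  have h2 := measurePreserving_update μ v
  have h3 := (MeasurePreserving.id μ).prod h1
  have h4 : MeasurePreserving (fun q : (ℕ × ℕ) × (X → ℕ) => (q.1.2, (q.1.1, q.2)))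
      ((μ.prod μ).prod (Measure.infinitePi fun _ : X => μ))
      (μ.prod (μ.prod (Measure.infinitePi fun _ : X => μ))) :=
    (measurePreserving_prodAssoc μ μ (Measure.infinitePi fun _ : X => μ)).comp
      ((Measure.measurePreserving_swap (μ := μ) (ν := μ)).prod (MeasurePreserving.id _))
  exact h2.comp (h3.comp h4)

/-- The mean of `f` given the occupation number at `u`. -/
noncomputable def siteMean (f : (X → ℕ) → ℝ) (u : X) (α : ℕ) : ℝ :=
  ∫ η, f (Function.update η u α) ∂(Measure.infinitePi fun _ : X => μ)

/-- The mean of `f` given the occupation numbers at `u` and `v`. -/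
noncomputable def pairMean (f : (X → ℕ) → ℝ) (u v : X) (q : ℕ × ℕ) : ℝ :=
  ∫ η, f (Function.update (Function.update η u q.1) v q.2) ∂(Measure.infinitePi fun _ : X => μ)

variable {μ} {f : (X → ℕ) → ℝ}

theorem hasSum_siteMean (hf : Integrable f (Measure.infinitePi fun _ : X => μ)) (u : X) :
    HasSum (fun α => μ.real {α} * siteMean μ f u α)
      (∫ η, f η ∂(Measure.infinitePi fun _ : X => μ)) := by
  have hmp := measurePreserving_update μ u
  have h1 := hmp.integrable_comp_of_integrable hf
  have h2 := hasSum_integral_countable h1.integral_prod_left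
  rw [← integral_prod _ h1] at h2
  simp only [Function.comp] at h2
  rwa [← integral_map hmp.measurable.aemeasurable
    (by rw [hmp.map_eq]; exact hf.aestronglyMeasurable), hmp.map_eq] at h2

theorem hasSum_pairMean (hf : Integrable f (Measure.infinitePi fun _ : X => μ)) (u v : X) :
    HasSum (fun q : ℕ × ℕ => μ.real {q.1} * μ.real {q.2} * pairMean μ f u v q)
      (∫ η, f η ∂(Measure.infinitePi fun _ : X => μ)) := by
  have hmp := measurePreserving_update_update μ u v
  have h1 := hmp.integrable_comp_of_integrable hf
  have h2 := hasSum_integral_countable h1.integral_prod_left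
  rw [← integral_prod _ h1] at h2
  simp only [Function.comp] at h2
  rw [← integral_map hmp.measurable.aemeasurable
    (by rw [hmp.map_eq]; exact hf.aestronglyMeasurable), hmp.map_eq] at h2
  convert h2 using 2 with q
  rw [← Prod.mk.eta (p := q), ← Set.singleton_prod_singleton, measureReal_prod_prod]
  rfl

theorem abs_pairMean_le {B : ℝ} (hB : ∀ η, |f η| ≤ B) (u v : X) (q : ℕ × ℕ) :
    |pairMean μ f u v q| ≤ B := by
  simpa [pairMean] using norm_integral_le_of_norm_le_const
    (μ := Measure.infinitePi fun _ : X => μ)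
    (f := fun η => f (Function.update (Function.update η u q.1) v q.2))
    (Eventually.of_forall fun η => hB _)

/-- The total rate of change of `f` through the jumps from `u` to `v`. -/
noncomputable def jumpSum (g : ℕ → ℕ → ℕ → ℝ) (f : (X → ℕ) → ℝ) (u v : X) (η : X → ℕ) : ℝ :=
  ∑ k ∈ Finset.Icc 1 (η u), g k (η u) (η v) * (f (jumpFun k u v η) - f η)

omit [IsProbabilityMeasure μ] in
theorem jumpFun_update {k α β : ℕ} (hk : k ≤ α) {u v : X} (huv : u ≠ v) (η : X → ℕ) :
    jumpFun k u v (Function.update (Function.update η u α) v β) =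
      Function.update (Function.update η u (α - k)) v (β + k) := by
  funext z
  by_cases h1 : z = v
  · subst h1; simp [jumpFun, huv, huv.symm, hk]
  · by_cases h2 : z = u
    · subst h2; simp [jumpFun, huv, hk]
    · simp [jumpFun, huv, hk, h1, h2]

theorem jumpSum_self (u : X) (η : X → ℕ) : jumpSum g f u u η = 0 := by
  refine Finset.sum_eq_zero fun k hk => ?_
  have : jumpFun k u u η = η := by
    have hk' := (Finset.mem_Icc.1 hk).2
    funext z
    by_cases h : z = u
    · subst h; simp [jumpFun, hk']
    · simp [jumpFun, hk', h]
  rw [this, sub_self, mul_zero]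

/-- With the values at `u` and `v` fixed, a jump only shifts these two values, so averaging over the
other sites leaves the two-site adjoint relation for `pairMean`. -/
theorem integral_jumpSum (hg : IsRate g) (hC : GrowthBound g C)
    (hμ : Integrable (fun n : ℕ => (n : ℝ)) μ) (hf : Measurable f) {B : ℝ} (hB : ∀ η, |f η| ≤ B)
    {u v : X} (huv : u ≠ v)
    (hI : Integrable (jumpSum g f u v) (Measure.infinitePi fun _ : X => μ)) :
    ∫ η, jumpSum g f u v η ∂(Measure.infinitePi fun _ : X => μ) =
      ∑' q, flux g (fun n => μ.real {n}) q * pairMean μ f u v q := by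
  have hm := isMarginal_measureReal hμ
  obtain ⟨S, h1, h2⟩ := hm.exists_hasSum_flux hg hC (abs_pairMean_le (μ := μ) hB u v)
  rw [h1.tsum_eq]
  refine (hasSum_pairMean hI u v).unique ?_
  convert h2 using 2 with q
  congr 1
  have hint : ∀ α β, Integrable (fun η => f (Function.update (Function.update η u α) v β))
      (Measure.infinitePi fun _ : X => μ) := fun α β => by
    refine Integrable.of_bound (hf.comp ?_).aestronglyMeasurable B
      (Eventually.of_forall fun η => hB _)
    exact measurable_update'.comp
      ((measurable_update'.comp (measurable_id.prodMk measurable_const)).prodMk measurable_const)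
  have hpt : ∀ η : X → ℕ, jumpSum g f u v (Function.update (Function.update η u q.1) v q.2) =
      ∑ k ∈ Finset.range (q.1 + 1), g k q.1 q.2 *
        (f (Function.update (Function.update η u (q.1 - k)) v (q.2 + k)) -
          f (Function.update (Function.update η u q.1) v q.2)) := fun η => by
    rw [hg.sum_range_eq]
    simp only [jumpSum, Function.update_self, Function.update_of_ne huv]
    refine Finset.sum_congr rfl fun k hk => ?_
    rw [jumpFun_update (Finset.mem_Icc.1 hk).2 huv]
  simp only [pairMean, hpt]
  rw [integral_finsetSum]
  · refine Finset.sum_congr rfl fun k _ => ?_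
    rw [integral_const_mul, integral_sub (hint _ _) (hint _ _)]
  · exact fun k _ => ((hint _ _).sub (hint _ _)).const_mul _

end Product

end MMP

namespace MMP

open Filter Topology

/-! ### The product measure is carried by the state space and has finite mean norm. -/

section Embedding

variable {X : Type*} [Countable X] {a : X → ℝ} {μ : Measure ℕ} [IsProbabilityMeasure μ]

omit [Countable X] in
theorem summable_iff_tsum_ofReal_ne_top {c : X → ℝ} (hc : ∀ x, 0 ≤ c x) :
    Summable c ↔ ∑' x, ENNReal.ofReal (c x) ≠ ⊤ := by
  refine ⟨Summable.tsum_ofReal_ne_top, fun h => ?_⟩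
  have := ENNReal.summable_toReal h
  simpa only [ENNReal.toReal_ofReal (hc _)] using this

omit [Countable X] in
theorem measurable_ofReal_coord (x : X) :
    Measurable fun η : X → ℕ => ENNReal.ofReal ((η x : ℝ) * a x) :=
  (Measurable.of_discrete (f := fun n : ℕ => ENNReal.ofReal (n * a x))).comp (measurable_pi_apply x)

theorem measurable_tsum_ofReal :
    Measurable fun η : X → ℕ => ∑' x, ENNReal.ofReal ((η x : ℝ) * a x) :=
  Measurable.tsum measurable_ofReal_coord

theorem measurableSet_summable (ha : ∀ x, 0 ≤ a x) :
    MeasurableSet {η : X → ℕ | Summable fun x => (η x : ℝ) * a x} := by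
  have : {η : X → ℕ | Summable fun x => (η x : ℝ) * a x} =
      (fun η : X → ℕ => ∑' x, ENNReal.ofReal ((η x : ℝ) * a x)) ⁻¹' {⊤}ᶜ := by
    ext η
    exact summable_iff_tsum_ofReal_ne_top fun x => mul_nonneg (Nat.cast_nonneg _) (ha x)
  rw [this]
  exact measurable_tsum_ofReal (measurableSet_singleton _).compl

omit [Countable X] in
theorem integrable_coord (hμ : Integrable (fun n : ℕ => (n : ℝ)) μ) (x : X) :
    Integrable (fun η : X → ℕ => (η x : ℝ)) (Measure.infinitePi fun _ : X => μ) :=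
  (measurePreserving_eval_infinitePi (fun _ : X => μ) x).integrable_comp_of_integrable hμ

omit [Countable X] in
theorem integral_coord (φ : ℕ → ℝ) (x : X) :
    ∫ η : X → ℕ, φ (η x) ∂(Measure.infinitePi fun _ : X => μ) = ∫ n, φ n ∂μ := by
  have h := measurePreserving_eval_infinitePi (fun _ : X => μ) x
  have h' := integral_map h.measurable.aemeasurable (f := φ)
    (μ := Measure.infinitePi fun _ : X => μ) Measurable.of_discrete.aestronglyMeasurable
  rw [h.map_eq] at h'
  exact h'.symm

theorem lintegral_tsum_ofReal_lt_top (hμ : Integrable (fun n : ℕ => (n : ℝ)) μ)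
    (ha : ∀ x, 0 ≤ a x) (has : Summable a) :
    ∫⁻ η, ∑' x, ENNReal.ofReal ((η x : ℝ) * a x) ∂(Measure.infinitePi fun _ : X => μ) < ⊤ := by
  rw [lintegral_tsum fun x => (measurable_ofReal_coord x).aemeasurable]
  have h : ∀ x, ∫⁻ η, ENNReal.ofReal ((η x : ℝ) * a x) ∂(Measure.infinitePi fun _ : X => μ) =
      ENNReal.ofReal ((∫ n, (n : ℝ) ∂μ) * a x) := fun x => by
    rw [← ofReal_integral_eq_lintegral_ofReal ((integrable_coord hμ x).mul_const _)
      (Eventually.of_forall fun η => mul_nonneg (Nat.cast_nonneg _) (ha x)), integral_mul_const,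
      integral_coord fun n => (n : ℝ)]
  simp only [h]
  exact (has.mul_left _).tsum_ofReal_lt_top

theorem ae_summable (hμ : Integrable (fun n : ℕ => (n : ℝ)) μ) (ha : ∀ x, 0 ≤ a x)
    (has : Summable a) :
    ∀ᵐ η ∂(Measure.infinitePi fun _ : X => μ), Summable fun x => (η x : ℝ) * a x := by
  filter_upwards [ae_lt_top measurable_tsum_ofReal (lintegral_tsum_ofReal_lt_top hμ ha has).ne]
    with η hη
  exact (summable_iff_tsum_ofReal_ne_top fun x => mul_nonneg (Nat.cast_nonneg _) (ha x)).2 hη.ne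

variable (a μ) in
/-- The product measure on the state space. -/
noncomputable def configMeasure : Measure (Config a) :=
  (Measure.infinitePi fun _ : X => μ).comap Subtype.val

theorem measurableEmbedding_val (ha : ∀ x, 0 ≤ a x) :
    MeasurableEmbedding (Subtype.val : Config a → X → ℕ) :=
  MeasurableEmbedding.subtype_coe (measurableSet_summable ha)

theorem measurePreserving_val (hμ : Integrable (fun n : ℕ => (n : ℝ)) μ) (ha : ∀ x, 0 ≤ a x)
    (has : Summable a) :
    MeasurePreserving (Subtype.val : Config a → X → ℕ) (configMeasure a μ)
      (Measure.infinitePi fun _ : X => μ) := by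
  refine ⟨measurable_subtype_coe, ?_⟩
  have h := map_comap_subtype_coe (measurableSet_summable ha) (Measure.infinitePi fun _ : X => μ)
  exact h.trans (Measure.restrict_eq_self_of_ae_mem (ae_summable hμ ha has))

theorem isProbabilityMeasure_configMeasure (hμ : Integrable (fun n : ℕ => (n : ℝ)) μ)
    (ha : ∀ x, 0 ≤ a x) (has : Summable a) : IsProbabilityMeasure (configMeasure a μ) := by
  have h := measurePreserving_val hμ ha has
  refine ⟨?_⟩
  rw [← Set.preimage_univ (f := (Subtype.val : Config a → X → ℕ)),
    h.measure_preimage MeasurableSet.univ.nullMeasurableSet, measure_univ]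

variable {p : X → X → ℝ}

theorem integrable_wnorm_configMeasure [DecidableEq X]
    (hμ : Integrable (fun n : ℕ => (n : ℝ)) μ) (ha : IsWeight p a) :
    Integrable wnorm (configMeasure a μ) := by
  have ha0 : ∀ x, 0 ≤ a x := fun x => (ha.pos x).le
  have hmp := measurePreserving_val hμ ha0 ha.summable
  refine ⟨(isLip_wnorm ha).measurable.aestronglyMeasurable, ?_⟩
  have h : ∀ η : Config a, ‖wnorm η‖ₑ = ∑' x, ENNReal.ofReal ((η.1 x : ℝ) * a x) := fun η => by
    rw [Real.enorm_of_nonneg (wnorm_nonneg ha η), wnorm, ENNReal.ofReal_tsum_of_nonneg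
      (fun x => mul_nonneg (Nat.cast_nonneg _) (ha0 x)) η.2]
  rw [hasFiniteIntegral_iff_enorm]
  simp only [h]
  have := hmp.lintegral_comp (measurable_tsum_ofReal (a := a))
  rw [this]
  exact lintegral_tsum_ofReal_lt_top hμ ha0 ha.summable

end Embedding

/-! ### Reduction to bounded functions of finitely many coordinates. -/

section Cylinder

variable {X : Type*} [DecidableEq X] [Countable X] {p : X → X → ℝ} {g : ℕ → ℕ → ℕ → ℝ}
  {a : X → ℝ} {C : ℝ} {μ : Measure ℕ} [IsProbabilityMeasure μ]
  {f : (X → ℕ) → ℝ} {Λ : Finset X} {B : ℝ}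

-- Configurations that differ somewhere on `Λ` are at distance at least some `a x` with `x ∈ Λ`,
-- while `f` varies by at most `2 * B`.
omit [Countable X] [DecidableEq X] in
theorem isLip_of_dependsOn (ha : IsWeight p a) (hf : DependsOn f (Λ : Set X))
    (hB : ∀ η, |f η| ≤ B) : IsLip fun η : Config a => f η.1 := by
  have hB0 : 0 ≤ B := (abs_nonneg _).trans (hB 0)
  have hnn : ∀ x ∈ Λ, 0 ≤ 2 * B / a x := fun x _ => div_nonneg (by positivity) (ha.pos x).le
  have hsum := Finset.sum_nonneg hnn
  -- The summand `1` keeps the constant positive when `Λ` is empty or `B = 0`.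
  refine ⟨∑ x ∈ Λ, 2 * B / a x + 1, by positivity, fun η ζ => ?_⟩
  have hd := wdist_nonneg ha η ζ
  by_cases h : ∀ x ∈ Λ, η.1 x = ζ.1 x
  · change |f η.1 - f ζ.1| ≤ _
    rw [hf h, sub_self, abs_zero]
    positivity
  · push Not at h
    obtain ⟨x, hx, hne⟩ := h
    have h1 : a x ≤ wdist η ζ := by
      by_contra hlt
      exact hne (eq_of_wdist_lt ha (not_le.1 hlt))
    have h2 := Finset.single_le_sum hnn hx
    have h3 : |f η.1 - f ζ.1| ≤ 2 * B := (abs_sub _ _).trans (by linarith [hB η.1, hB ζ.1])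
    have h4 : 2 * B = 2 * B / a x * a x := by
      have := (ha.pos x).ne'
      field_simp
    calc |f η.1 - f ζ.1| ≤ 2 * B / a x * a x := h3.trans h4.le
      _ ≤ (∑ x ∈ Λ, 2 * B / a x + 1) * wdist η ζ :=
        mul_le_mul (by linarith) h1 (ha.pos x).le (by positivity)

omit [Countable X] in
theorem measurable_jumpSum (hf : Measurable f) (u v : X) : Measurable (jumpSum g f u v) := by
  have h : Measurable fun z : (X → ℕ) × (ℕ × ℕ) => ∑ k ∈ Finset.Icc 1 z.2.1,
      g k z.2.1 z.2.2 * (f (jumpFun k u v z.1) - f z.1) :=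
    measurable_from_prod_countable_left fun n =>
      Finset.measurable_fun_sum (Finset.Icc 1 n.1) fun k _ =>
        ((hf.comp (measurable_jumpFun k u v)).sub hf).const_mul (g k n.1 n.2)
  exact h.comp (measurable_id.prodMk ((measurable_pi_apply u).prodMk (measurable_pi_apply v)))

omit [Countable X] in
theorem integrable_jumpSum (hg : IsRate g) (hC : GrowthBound g C)
    (hμ : Integrable (fun n : ℕ => (n : ℝ)) μ) (hf : Measurable f) (hB : ∀ η, |f η| ≤ B) (u v : X) :
    Integrable (jumpSum g f u v) (Measure.infinitePi fun _ : X => μ) := by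
  have hB0 : 0 ≤ B := (abs_nonneg _).trans (hB 0)
  refine ((((integrable_coord hμ u).add (integrable_coord hμ v)).const_mul C).mul_const
    (2 * B)).mono' (measurable_jumpSum hf u v).aestronglyMeasurable
    (Eventually.of_forall fun η => ?_)
  calc |jumpSum g f u v η| ≤ ∑ k ∈ Finset.Icc 1 (η u), g k (η u) (η v) * (2 * B) := by
        refine (Finset.abs_sum_le_sum_abs _ _).trans (Finset.sum_le_sum fun k _ => ?_)
        rw [abs_mul, abs_of_nonneg (hg.nonneg _ _ _)]
        refine mul_le_mul_of_nonneg_left ((abs_sub _ _).trans ?_) (hg.nonneg _ _ _)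
        linarith [hB (jumpFun k u v η), hB η]
    _ ≤ _ := by
        rw [← Finset.sum_mul]
        exact mul_le_mul_of_nonneg_right (hC.sum_le hg _ _) (by positivity)

variable (μ g f) in
/-- The mean rate of change of `f` through the jumps from `u` to `v`. -/
noncomputable def pairFlux (u v : X) : ℝ :=
  if u = v then 0 else ∑' q, flux g (fun n => μ.real {n}) q * pairMean μ f u v q

omit [Countable X] in
theorem integral_jumpSum_eq_pairFlux (hg : IsRate g) (hC : GrowthBound g C)
    (hμ : Integrable (fun n : ℕ => (n : ℝ)) μ) (hf : Measurable f) (hB : ∀ η, |f η| ≤ B) (u v : X) :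
    ∫ η, jumpSum g f u v η ∂(Measure.infinitePi fun _ : X => μ) = pairFlux g μ f u v := by
  by_cases huv : u = v
  · subst huv
    simp [jumpSum_self, pairFlux]
  · rw [pairFlux, if_neg huv, integral_jumpSum hg hC hμ hf hB huv
      (integrable_jumpSum hg hC hμ hf hB u v)]

theorem hasSum_integral_generator (hA : Admissible p g a C)
    (hμ : Integrable (fun n : ℕ => (n : ℝ)) μ) (hf : DependsOn f (Λ : Set X))
    (hB : ∀ η, |f η| ≤ B) :
    HasSum (fun q : X × X => p q.1 q.2 * pairFlux g μ f q.1 q.2)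
      (∫ η, generator p g (fun η => f η.1) η ∂(configMeasure a μ)) := by
  have ha0 : ∀ x, 0 ≤ a x := fun x => (hA.weight.pos x).le
  have hmp := measurePreserving_val hμ ha0 hA.weight.summable
  have hme := measurableEmbedding_val ha0
  have hfm := measurable_of_dependsOn hf
  obtain ⟨L, hL, hLip⟩ := isLip_of_dependsOn hA.weight hf hB
  have hterm : ∀ (q : X × X) (η : Config a), genTerm p g (fun η => f η.1) η q =
      p q.1 q.2 * jumpSum g f q.1 q.2 η.1 := fun q η => by
    rw [genTerm, jumpSum, Finset.mul_sum]
    exact Finset.sum_congr rfl fun k _ => mul_assoc _ _ _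
  have hint : ∀ q : X × X, Integrable (fun η => genTerm p g (fun η => f η.1) η q)
      (configMeasure a μ) := fun q => by
    simp only [hterm]
    exact (hmp.integrable_comp_of_integrable
      (integrable_jumpSum hA.rate hA.growth hμ hfm hB q.1 q.2)).const_mul _
  have hcoord : ∀ x, Integrable (fun η : Config a => (η.1 x : ℝ)) (configMeasure a μ) := fun x =>
    hmp.integrable_comp_of_integrable (integrable_coord hμ x)
  have hmean : ∀ x, ∫ η : Config a, (η.1 x : ℝ) ∂(configMeasure a μ) = ∫ n, (n : ℝ) ∂μ := fun x =>
    (hmp.integral_comp hme fun η : X → ℕ => (η x : ℝ)).trans (integral_coord (fun n => (n : ℝ)) x)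
  have hpw : Summable (pairWeight p a) := by
    refine ((hasSum_row hA.prob ha0 hA.weight.summable).add
      (hasSum_col hA.prob hA.col ha0 hA.weight.summable)).summable.congr fun q => ?_
    rw [pairWeight, mul_add]
  have hsum : Summable fun q : X × X =>
      ∫ η, ‖genTerm p g (fun η => f η.1) η q‖ ∂(configMeasure a μ) := by
    refine Summable.of_nonneg_of_le (fun q => integral_nonneg fun η => norm_nonneg _) (fun q => ?_)
      ((hpw.mul_right (∫ n, (n : ℝ) ∂μ + ∫ n, (n : ℝ) ∂μ)).mul_left (L * C))
    have h1 := integral_mono (hint q).norm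
      ((((hcoord q.1).add (hcoord q.2)).const_mul (pairWeight p a q)).const_mul (L * C))
      fun η => abs_genTerm_le hA.prob hA.weight hA.rate hA.growth hL hLip η q
    rwa [integral_const_mul, integral_const_mul, integral_add' (hcoord _) (hcoord _), hmean,
      hmean] at h1
  have h := hasSum_integral_of_summable_integral_norm hint hsum
  refine h.congr_fun fun q => ?_
  simp only [hterm, integral_const_mul]
  rw [hmp.integral_comp hme, integral_jumpSum_eq_pairFlux hA.rate hA.growth hμ hfm hB]

theorem summable_mul_pairFlux (hA : Admissible p g a C)
    (hμ : Integrable (fun n : ℕ => (n : ℝ)) μ) (hf : DependsOn f (Λ : Set X))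
    (hB : ∀ η, |f η| ≤ B) : Summable fun q : X × X => p q.1 q.2 * pairFlux g μ f q.1 q.2 :=
  (hasSum_integral_generator hA hμ hf hB).summable

/-- Composing `f` with truncation to `Λ` does not increase the Lipschitz constant. Domination is
thus uniform in `Λ`, both for the sum over pairs and for the integral. -/
theorem integral_generator_eq_zero (hA : Admissible p g a C) {κ : Measure (Config a)}
    (hκ : Integrable wnorm κ)
    (h : ∀ (Λ : Finset X) (f : (X → ℕ) → ℝ), DependsOn f (Λ : Set X) →
      (∃ B, ∀ η, |f η| ≤ B) → ∫ η, generator p g (fun η => f η.1) η ∂κ = 0)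
    {f : Config a → ℝ} (hf : IsLip f) (hB : ∃ B, ∀ η, |f η| ≤ B) :
    ∫ η, generator p g f η ∂κ = 0 := by
  have hf' := hf
  obtain ⟨L, hL, hLip⟩ := hf
  obtain ⟨B, hB⟩ := hB
  obtain ⟨K, hK0, hK⟩ := exists_abs_generator_le hA.prob hA.col hA.weight hA.rate hA.growth
  let F : Finset X → Config a → ℝ := fun Λ η => f (restrictTo a Λ η.1)
  have hF : ∀ Λ η ζ, |F Λ η - F Λ ζ| ≤ L * wdist η ζ := fun Λ η ζ =>
    (hLip _ _).trans (mul_le_mul_of_nonneg_left (wdist_restrictTo_le hA.weight Λ η ζ) hL.le)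
  have hlim : ∀ η, Tendsto (fun Λ => generator p g (F Λ) η) atTop (𝓝 (generator p g f η)) :=
    fun η => by
    simp only [generator_eq_tsum]
    refine tendsto_tsum_of_dominated_convergence
      ((summable_pairWeight hA.prob hA.col hA.weight η).mul_left (L * C)) (fun q => ?_)
      (Eventually.of_forall fun Λ q =>
        abs_genTerm_le hA.prob hA.weight hA.rate hA.growth hL (hF Λ) η q)
    exact tendsto_finsetSum _ fun k _ => ((hf'.tendsto_restrictTo _).sub
      (hf'.tendsto_restrictTo η)).const_mul _
  have h2 : Tendsto (fun Λ => ∫ η, generator p g (F Λ) η ∂κ) atTop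
      (𝓝 (∫ η, generator p g f η ∂κ)) := by
    refine tendsto_integral_filter_of_dominated_convergence (fun η => L * K * wnorm η)
      (Eventually.of_forall fun Λ => ?_)
      (Eventually.of_forall fun Λ => Eventually.of_forall (hK (F Λ) L hL (hF Λ)))
      (hκ.const_mul _) (Eventually.of_forall hlim)
    exact (hA.measurable_generator ⟨L, hL, hF Λ⟩).aestronglyMeasurable
  have h3 : ∀ Λ, ∫ η, generator p g (F Λ) η ∂κ = 0 := fun Λ =>
    h Λ (fun η => f (restrictTo a Λ η)) (dependsOn_restrictTo f Λ) ⟨B, fun η => hB _⟩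
  simp only [h3] at h2
  exact tendsto_nhds_unique h2 tendsto_const_nhds

/-- Invariance of the product measure, in terms of the mean rates of change of the bounded
functions of finitely many occupation numbers. -/
theorem isInvariant_infinitePi_iff (hA : Admissible p g a C)
    (hμ : Integrable (fun n : ℕ => (n : ℝ)) μ)
    {P : ℝ≥0 → Kernel (Config a) (Config a)} (hP : IsProcess p g P) :
    IsInvariant P (Measure.infinitePi fun _ : X => μ) ↔
      ∀ (Λ : Finset X) (f : (X → ℕ) → ℝ), DependsOn f (Λ : Set X) → (∃ B, ∀ η, |f η| ≤ B) →
        HasSum (fun q : X × X => p q.1 q.2 * pairFlux g μ f q.1 q.2) 0 := by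
  have ha0 : ∀ x, 0 ≤ a x := fun x => (hA.weight.pos x).le
  have hprob := isProbabilityMeasure_configMeasure hμ ha0 hA.weight.summable
  have hw := integrable_wnorm_configMeasure hμ hA.weight
  have hiff := integral_act_eq_iff hA hP hw
  constructor
  · rintro ⟨-, h⟩ Λ f hf ⟨B, hB⟩
    have h1 := hiff.1 h _ (isLip_of_dependsOn hA.weight hf hB) ⟨B, fun η => hB _⟩
    exact h1 ▸ hasSum_integral_generator hA hμ hf hB
  · refine fun h => ⟨ae_summable hμ ha0 hA.weight.summable, hiff.2 fun f hf hB => ?_⟩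
    refine integral_generator_eq_zero hA hw (fun Λ f hf ⟨B, hB⟩ => ?_) hf hB
    exact (hasSum_integral_generator hA hμ hf hB).unique (h Λ f hf ⟨B, hB⟩)

end Cylinder

end MMP

namespace MMP

/-! ### Irreducibility and double stochasticity. -/

section Sites

variable {X : Type*} {p : X → X → ℝ}

theorem IsIrreducible.exists_pos [Nontrivial X] (h : IsIrreducible p) (x : X) :
    ∃ y, y ≠ x ∧ 0 < p x y := by
  by_contra! hx
  obtain ⟨z, hz⟩ := exists_ne x
  have hxz := h x z
  refine hz ?_
  clear hz
  induction hxz with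
  | refl => rfl
  | tail _ hbc ih =>
    subst ih
    by_contra hc
    exact absurd hbc (not_lt.2 (hx _ hc))

theorem IsTransitionProbability.self_lt_one [Nontrivial X] (hp : IsTransitionProbability p)
    (h : IsIrreducible p) (x : X) : p x x < 1 := by
  classical
  obtain ⟨y, hy, hpos⟩ := h.exists_pos x
  have := sum_le_hasSum {x, y} (fun z _ => hp.nonneg x z) (hp.hasSum x)
  rw [Finset.sum_pair hy.symm] at this
  linarith

/-- Translation by `y - x` turns `p x y` into `p y (2y - x)`, so the column at `y` is the reflected
row at `y`. -/
theorem IsTranslationInvariant.hasSum_col {X : Type*} [AddCommGroup X] {p : X → X → ℝ}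
    (hti : IsTranslationInvariant p) (hp : IsTransitionProbability p) (y : X) :
    HasSum (fun x => p x y) 1 := by
  have h := (Equiv.subLeft (y + y)).hasSum_iff.2 (hp.hasSum y)
  refine h.congr_fun fun x => ?_
  have := hti x y (y - x)
  rw [← this]
  simp only [Function.comp, Equiv.subLeft_apply]
  congr 1 <;> abel

/-- Both halves sum to `∑ c`. Writing `c = |c| - (|c| - c)` reduces to nonnegative functions. -/
theorem hasSum_mul_sub (hp : IsTransitionProbability p) (hcol : ∀ y, HasSum (fun x => p x y) 1)
    {c : X → ℝ} (hc : Summable c) :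
    HasSum (fun q : X × X => p q.1 q.2 * (c q.2 - c q.1)) 0 := by
  have h0 : ∀ x, 0 ≤ |c x| := fun x => abs_nonneg _
  have h1 : ∀ x, 0 ≤ |c x| - c x := fun x => sub_nonneg.2 (le_abs_self _)
  have hr := (hasSum_row hp h0 hc.abs).sub (hasSum_row hp h1 (hc.abs.sub hc))
  have hl := (hasSum_col hp hcol h0 hc.abs).sub (hasSum_col hp hcol h1 (hc.abs.sub hc))
  have h := hl.sub hr
  rw [sub_self] at h
  refine h.congr_fun fun q => ?_
  ring

end Sites

section PairFlux

variable {X : Type*} [DecidableEq X] {p : X → X → ℝ} {g : ℕ → ℕ → ℕ → ℝ} {C : ℝ} {μ : Measure ℕ}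
  [IsProbabilityMeasure μ] {f : (X → ℕ) → ℝ}

omit [IsProbabilityMeasure μ] in
theorem pairFlux_self (u : X) : pairFlux g μ f u u = 0 := if_pos rfl

omit [IsProbabilityMeasure μ] in
theorem pairFlux_of_pairMean {u v : X} (huv : u ≠ v) {F : ℕ × ℕ → ℝ} {c : ℝ}
    (h : ∀ q, pairMean μ f u v q = F q * c) :
    pairFlux g μ f u v = (∑' q, flux g (fun n => μ.real {n}) q * F q) * c := by
  rw [pairFlux, if_neg huv, ← tsum_mul_right]
  exact tsum_congr fun q => by rw [h, mul_assoc]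

omit [IsProbabilityMeasure μ] in
theorem pairMean_swap {u v : X} (huv : u ≠ v) (q : ℕ × ℕ) :
    pairMean μ f v u q = pairMean μ f u v q.swap := by
  simp only [pairMean, Prod.fst_swap, Prod.snd_swap]
  simp only [Function.update_comm huv]

end PairFlux

/-! ### Necessity: testing with products of functions of two occupation numbers. -/

section Necessity

variable {X : Type*} [DecidableEq X] {p : X → X → ℝ} {g : ℕ → ℕ → ℕ → ℝ} {C : ℝ} {μ : Measure ℕ}
  [IsProbabilityMeasure μ]

/-- A product of functions of the occupation numbers at two sites. -/
def prodTest (φ χ : ℕ → ℝ) (x y : X) (η : X → ℕ) : ℝ := φ (η x) * χ (η y)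

/-- The net flux, as a bilinear form on functions of a single occupation number. -/
noncomputable def fluxForm (g : ℕ → ℕ → ℕ → ℝ) (m : ℕ → ℝ) (φ χ : ℕ → ℝ) : ℝ :=
  ∑' q : ℕ × ℕ, flux g m q * (φ q.1 * χ q.2)

theorem dependsOn_prodTest (φ χ : ℕ → ℝ) (x y : X) :
    DependsOn (prodTest φ χ x y) (({x, y} : Finset X) : Set X) := by
  intro η ζ h
  rw [prodTest, prodTest, h x (by simp), h y (by simp)]

omit [DecidableEq X] in
theorem abs_prodTest_le {φ χ : ℕ → ℝ} (hφ : ∀ n, |φ n| ≤ 1) (hχ : ∀ n, |χ n| ≤ 1) (x y : X)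
    (η : X → ℕ) : |prodTest φ χ x y η| ≤ 1 := by
  rw [prodTest, abs_mul]
  exact mul_le_one₀ (hφ _) (abs_nonneg _) (hχ _)

variable {φ χ : ℕ → ℝ} {x y : X}

theorem pairFlux_prodTest_pair (hxy : x ≠ y) :
    pairFlux g μ (prodTest φ χ x y) x y = fluxForm g (fun n => μ.real {n}) φ χ := by
  rw [pairFlux_of_pairMean hxy (F := fun q => φ q.1 * χ q.2) (c := 1) fun q => ?_, mul_one]
  · rfl
  · simp [pairMean, prodTest, hxy]

theorem pairFlux_prodTest_pair_symm (hxy : x ≠ y) :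
    pairFlux g μ (prodTest φ χ x y) y x = fluxForm g (fun n => μ.real {n}) χ φ := by
  rw [pairFlux_of_pairMean hxy.symm (F := fun q => χ q.1 * φ q.2) (c := 1) fun q => ?_, mul_one]
  · rfl
  · simp [pairMean, prodTest, hxy.symm, mul_comm]

theorem pairFlux_prodTest_left (hxy : x ≠ y) {v : X} (hvx : v ≠ x) (hvy : v ≠ y) :
    pairFlux g μ (prodTest φ χ x y) x v =
      fluxForm g (fun n => μ.real {n}) φ (fun _ => 1) * ∫ n, χ n ∂μ := by
  refine pairFlux_of_pairMean hvx.symm fun q => ?_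
  simp [pairMean, prodTest, hxy.symm, hvx.symm, hvy.symm, integral_const_mul, integral_coord]

theorem pairFlux_prodTest_right (hxy : x ≠ y) {u : X} (hux : u ≠ x) (huy : u ≠ y) :
    pairFlux g μ (prodTest φ χ x y) u x =
      fluxForm g (fun n => μ.real {n}) (fun _ => 1) φ * ∫ n, χ n ∂μ := by
  refine pairFlux_of_pairMean hux fun q => ?_
  simp [pairMean, prodTest, hxy.symm, huy.symm, integral_const_mul, integral_coord]

omit [DecidableEq X] in
theorem prodTest_comm : prodTest φ χ x y = prodTest χ φ y x := by
  funext η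
  exact mul_comm _ _

theorem pairFlux_prodTest_of_ne (hg : IsRate g) (hC : GrowthBound g C)
    (hμ : Integrable (fun n : ℕ => (n : ℝ)) μ) {u v : X} (hux : u ≠ x) (huy : u ≠ y) (hvx : v ≠ x)
    (hvy : v ≠ y) : pairFlux g μ (prodTest φ χ x y) u v = 0 := by
  by_cases huv : u = v
  · rw [huv, pairFlux_self]
  · rw [pairFlux_of_pairMean huv (F := fun _ => 1) (c := ∫ η, prodTest φ χ x y η
      ∂(Measure.infinitePi fun _ : X => μ)) fun q => ?_]
    · simp only [mul_one]
      rw [(isMarginal_measureReal hμ).tsum_flux hg hC, zero_mul]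
    · simp [pairMean, prodTest, hux.symm, huy.symm, hvx.symm, hvy.symm]

theorem hasSum_single_row (hp : IsTransitionProbability p) (x : X) (c : ℝ) :
    HasSum (fun q : X × X => if q.1 = x then p q.1 q.2 * c else 0) c := by
  have h : HasSum ((fun q : X × X => if q.1 = x then p q.1 q.2 * c else 0) ∘ fun y => (x, y)) c := by
    simpa [Function.comp_def] using (hp.hasSum x).mul_right c
  refine ((Prod.mk_right_injective x).hasSum_iff fun q hq => if_neg fun h => hq ?_).1 h
  exact ⟨q.2, Prod.ext h.symm rfl⟩

theorem hasSum_single_col (hcol : ∀ y, HasSum (fun x => p x y) 1) (y : X) (c : ℝ) :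
    HasSum (fun q : X × X => if q.2 = y then p q.1 q.2 * c else 0) c := by
  have h : HasSum ((fun q : X × X => if q.2 = y then p q.1 q.2 * c else 0) ∘ fun x => (x, y)) c := by
    simpa [Function.comp_def] using (hcol y).mul_right c
  refine ((Prod.mk_left_injective y).hasSum_iff fun q hq => if_neg fun h => hq ?_).1 h
  exact ⟨q.1, Prod.ext rfl h.symm⟩

/-- The total mean rate of change of a product of functions of two occupation numbers. -/
theorem hasSum_pairFlux_prodTest (hp : IsTransitionProbability p)
    (hcol : ∀ y, HasSum (fun x => p x y) 1) (hg : IsRate g) (hC : GrowthBound g C)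
    (hμ : Integrable (fun n : ℕ => (n : ℝ)) μ) (hxy : x ≠ y) {c₁ c₂ c₃ c₄ : ℝ}
    (h₁ : c₁ = fluxForm g (fun n => μ.real {n}) φ (fun _ => 1) * ∫ n, χ n ∂μ)
    (h₂ : c₂ = fluxForm g (fun n => μ.real {n}) (fun _ => 1) φ * ∫ n, χ n ∂μ)
    (h₃ : c₃ = fluxForm g (fun n => μ.real {n}) χ (fun _ => 1) * ∫ n, φ n ∂μ)
    (h₄ : c₄ = fluxForm g (fun n => μ.real {n}) (fun _ => 1) χ * ∫ n, φ n ∂μ) :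
    HasSum (fun q : X × X => p q.1 q.2 * pairFlux g μ (prodTest φ χ x y) q.1 q.2)
      (c₁ + c₂ + c₃ + c₄ +
        p x y * (fluxForm g (fun n => μ.real {n}) φ χ - c₁ - c₄) +
        p y x * (fluxForm g (fun n => μ.real {n}) χ φ - c₃ - c₂) +
        p x x * (-c₁ - c₂) + p y y * (-c₃ - c₄)) := by
  -- Only pairs meeting `{x, y}` contribute. Rows and columns through `x` and `y` are summed with
  -- their generic values `c₁`, …, `c₄`, then corrected at the four pairs inside `{x, y}`, where a
  -- row meets a column.
  have h := (((((((hasSum_single_row hp x c₁).add (hasSum_single_col hcol x c₂)).add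
    (hasSum_single_row hp y c₃)).add (hasSum_single_col hcol y c₄)).add
    (hasSum_ite_eq (x, y) (p x y * (fluxForm g (fun n => μ.real {n}) φ χ - c₁ - c₄)))).add
    (hasSum_ite_eq (y, x) (p y x * (fluxForm g (fun n => μ.real {n}) χ φ - c₃ - c₂)))).add
    (hasSum_ite_eq (x, x) (p x x * (-c₁ - c₂)))).add
    (hasSum_ite_eq (y, y) (p y y * (-c₃ - c₄)))
  refine h.congr_fun fun ⟨u, v⟩ => ?_
  simp only [Prod.mk.injEq]
  have hxy' := hxy.symm
  by_cases hux : u = x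
  · subst hux
    by_cases hvx : v = u
    · subst hvx
      simp only [pairFlux_self, hxy, if_true, if_false, and_self, and_false, and_true]
      ring
    · by_cases hvy : v = y
      · subst hvy
        simp only [pairFlux_prodTest_pair hxy, hxy, hxy', if_true, if_false, and_self, and_false,
          and_true]
        ring
      · simp only [pairFlux_prodTest_left hxy hvx hvy, hxy, hvx, hvy, if_true, if_false, and_false,
          ← h₁]
        ring
  · by_cases huy : u = y
    · subst huy
      by_cases hvx : v = x
      · subst hvx
        simp only [pairFlux_prodTest_pair_symm hxy, hxy, hxy', if_true, if_false, and_self,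
          and_false, and_true]
        ring
      · by_cases hvy : v = u
        · subst hvy
          simp only [pairFlux_self, hxy', if_true, if_false, and_self, and_false, and_true]
          ring
        · simp only [prodTest_comm (φ := φ), pairFlux_prodTest_left hxy' hvy hvx, hxy', hvx, hvy,
            if_true, if_false, and_false, ← h₃]
          ring
    · by_cases hvx : v = x
      · subst hvx
        simp only [pairFlux_prodTest_right hxy hux huy, hxy, hux, huy, if_true, if_false,
          false_and, and_true, ← h₂]
        ring
      · by_cases hvy : v = y
        · subst hvy
          simp only [prodTest_comm (φ := φ), pairFlux_prodTest_right hxy' huy hux, hxy', hux, huy,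
            if_true, if_false, false_and, and_true, ← h₄]
          ring
        · simp only [pairFlux_prodTest_of_ne hg hC hμ hux huy hvx hvy, hux, huy, hvx, hvy, if_false,
            false_and]
          ring

theorem fluxForm_one_one (hg : IsRate g) (hC : GrowthBound g C)
    (hμ : Integrable (fun n : ℕ => (n : ℝ)) μ) :
    fluxForm g (fun n => μ.real {n}) (fun _ => 1) (fun _ => 1) = 0 := by
  simpa [fluxForm] using (isMarginal_measureReal hμ).tsum_flux hg hC

theorem abs_indicator_one_le (α n : ℕ) : |Set.indicator {α} (1 : ℕ → ℝ) n| ≤ 1 := by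
  by_cases h : n = α <;> simp [h]

theorem fluxForm_indicator (m : ℕ → ℝ) (α β : ℕ) :
    fluxForm g m (Set.indicator {α} 1) (Set.indicator {β} 1) = flux g m (α, β) := by
  rw [fluxForm, tsum_eq_single (α, β)]
  · simp
  · rintro ⟨i, j⟩ h
    by_cases hi : i = α
    · by_cases hj : j = β
      · exact absurd (by rw [hi, hj]) h
      · simp [hj]
    · simp [hi]

/-- The indicator of a null pair of values has mean zero, which kills the loss term for every pair
of sites. What remains is a vanishing sum of nonnegative gains; the term at `(x, y)` is the claim.
-/
theorem supportCondition_of_hasSum (hp : IsTransitionProbability p) (hg : IsRate g)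
    (hμ : Integrable (fun n : ℕ => (n : ℝ)) μ)
    (h : ∀ (Λ : Finset X) (f : (X → ℕ) → ℝ), DependsOn f (Λ : Set X) → (∃ B, ∀ η, |f η| ≤ B) →
      HasSum (fun q : X × X => p q.1 q.2 * pairFlux g μ f q.1 q.2) 0)
    (hxy : x ≠ y) (hpos : 0 < p x y) : SupportCondition g fun n => μ.real {n} := by
  intro α β h0
  set f : (X → ℕ) → ℝ := prodTest (Set.indicator {α} 1) (Set.indicator {β} 1) x y
  have hm := isMarginal_measureReal hμ
  have hdep := dependsOn_prodTest (Set.indicator {α} (1 : ℕ → ℝ)) (Set.indicator {β} 1) x y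
  have hB : ∀ η, |f η| ≤ 1 :=
    abs_prodTest_le (abs_indicator_one_le α) (abs_indicator_one_le β) x y
  have hf0 : ∀ η, 0 ≤ f η := fun η =>
    mul_nonneg (Set.indicator_nonneg (fun _ _ => zero_le_one) _)
      (Set.indicator_nonneg (fun _ _ => zero_le_one) _)
  have hpm : ∀ u v q, 0 ≤ pairMean μ f u v q := fun u v q => integral_nonneg fun η => hf0 _
  have hfint : Integrable f (Measure.infinitePi fun _ : X => μ) :=
    Integrable.of_bound (measurable_of_dependsOn hdep).aestronglyMeasurable 1
      (Filter.Eventually.of_forall hB)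
  have hmean : ∫ η, f η ∂(Measure.infinitePi fun _ : X => μ) = 0 := by
    refine (hasSum_pairMean hfint x y).unique ?_
    refine hasSum_zero.congr_fun fun q => ?_
    by_cases h1 : q.1 = α
    · by_cases h2 : q.2 = β
      · rw [h1, h2, h0, zero_mul]
      · simp [pairMean, f, prodTest, h2]
    · simp [pairMean, f, prodTest, hxy, h1]
  have hnull : ∀ u v q, μ.real {q.1} * μ.real {q.2} * pairMean μ f u v q = 0 := fun u v => by
    have h1 := hasSum_pairMean hfint u v
    rw [hmean] at h1
    have h2 := (hasSum_zero_iff_of_nonneg fun q : ℕ × ℕ =>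
      mul_nonneg (mul_nonneg (hm.nonneg q.1) (hm.nonneg q.2)) (hpm u v q)).1 h1
    exact fun q => congrFun h2 q
  have hpf : ∀ u v, 0 ≤ pairFlux g μ f u v := fun u v => by
    rw [pairFlux]
    split_ifs with huv
    · exact le_rfl
    · refine tsum_nonneg fun q => ?_
      rw [flux, sub_mul, mul_right_comm, hnull, zero_mul, sub_zero]
      exact mul_nonneg (gain_nonneg hm hg q) (hpm u v q)
  have hz := (hasSum_zero_iff_of_nonneg fun q : X × X =>
    mul_nonneg (hp.nonneg q.1 q.2) (hpf q.1 q.2)).1 (h _ f hdep ⟨1, hB⟩)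
  have hxy0 : p x y * pairFlux g μ f x y = 0 := congrFun hz (x, y)
  rw [pairFlux_prodTest_pair hxy, fluxForm_indicator] at hxy0
  have h1 := (mul_eq_zero.1 hxy0).resolve_left hpos.ne'
  rw [flux, h0, zero_mul, sub_zero] at h1
  exact h1

/-- The balance of the net fluxes between the occupation numbers of two sites. -/
theorem flux_balance (hp : IsTransitionProbability p) (hcol : ∀ y, HasSum (fun x => p x y) 1)
    (hlt : ∀ x, p x x < 1) (hg : IsRate g) (hC : GrowthBound g C)
    (hμ : Integrable (fun n : ℕ => (n : ℝ)) μ)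
    (h : ∀ (Λ : Finset X) (f : (X → ℕ) → ℝ), DependsOn f (Λ : Set X) → (∃ B, ∀ η, |f η| ≤ B) →
      HasSum (fun q : X × X => p q.1 q.2 * pairFlux g μ f q.1 q.2) 0) :
    ∃ r : ℕ → ℝ, ∀ x y : X, x ≠ y → ∀ α β : ℕ,
      p x y * (flux g (fun n => μ.real {n}) (α, β) - (r α * μ.real {β} - r β * μ.real {α})) +
      p y x * (flux g (fun n => μ.real {n}) (β, α) - (r β * μ.real {α} - r α * μ.real {β})) = 0 := by
  set m : ℕ → ℝ := fun n => μ.real {n}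
  -- A test function of the value at `x` alone leaves the factor `1 - p x x`, positive since `p x x
  -- < 1`.
  have hbal : ∀ (x y : X), x ≠ y → ∀ α : ℕ, fluxForm g m (fun _ => 1) (Set.indicator {α} 1) =
      -fluxForm g m (Set.indicator {α} 1) (fun _ => 1) := fun x y hxy α => by
    have h1 := hasSum_pairFlux_prodTest (φ := Set.indicator {α} 1) (χ := fun _ => 1) hp hcol hg hC
      hμ hxy rfl rfl rfl rfl
    have h2 := (h _ _ (dependsOn_prodTest _ _ x y)
      ⟨1, abs_prodTest_le (abs_indicator_one_le α) (by simp) x y⟩).unique h1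
    rw [fluxForm_one_one hg hC hμ] at h2
    simp only [integral_const, probReal_univ, one_smul, mul_one, zero_mul] at h2
    have h3 : (fluxForm g m (Set.indicator {α} 1) (fun _ => 1) +
        fluxForm g m (fun _ => 1) (Set.indicator {α} 1)) * (1 - p x x) = 0 := by
      rw [h2]; ring
    have h4 := (mul_eq_zero.1 h3).resolve_right (sub_pos.2 (hlt x)).ne'
    linarith
  have hmean : ∀ α, ∫ n, Set.indicator {α} (1 : ℕ → ℝ) n ∂μ = m α := fun α =>
    integral_indicator_one (measurableSet_singleton α)
  -- This `r α` is the net flux into the value `α` at the departure site. By `hbal` the arrival site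
  -- has the opposite flux, so the generic row and column contributions cancel.
  refine ⟨fun α => fluxForm g m (Set.indicator {α} 1) (fun _ => 1), fun x y hxy α β => ?_⟩
  have h1 := hasSum_pairFlux_prodTest (φ := Set.indicator {α} 1) (χ := Set.indicator {β} 1) hp hcol
    hg hC hμ hxy rfl rfl rfl rfl
  have h2 := (h _ _ (dependsOn_prodTest _ _ x y)
    ⟨1, abs_prodTest_le (abs_indicator_one_le α) (abs_indicator_one_le β) x y⟩).unique h1
  rw [hbal x y hxy α, hbal x y hxy β, hmean, hmean, fluxForm_indicator, fluxForm_indicator] at h2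
  rw [h2]
  simp only [m]
  ring

end Necessity

/-! ### Sufficiency: antisymmetric fluxes and fluxes with a potential. -/

section Sufficiency

variable {X : Type*} [DecidableEq X] {p : X → X → ℝ} {g : ℕ → ℕ → ℕ → ℝ} {C : ℝ} {μ : Measure ℕ}
  [IsProbabilityMeasure μ] {f : (X → ℕ) → ℝ} {Λ : Finset X} {B : ℝ}

omit [IsProbabilityMeasure μ] in
theorem pairFlux_swap (hanti : ∀ α β, flux g (fun n => μ.real {n}) (β, α) =
    -flux g (fun n => μ.real {n}) (α, β)) (u v : X) :
    pairFlux g μ f v u = -pairFlux g μ f u v := by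
  by_cases huv : u = v
  · rw [huv, pairFlux_self, neg_zero]
  · rw [pairFlux, if_neg (Ne.symm huv), pairFlux, if_neg huv, ← tsum_neg,
      ← (Equiv.prodComm ℕ ℕ).tsum_eq]
    refine tsum_congr fun ⟨α, β⟩ => ?_
    rw [pairMean_swap huv]
    simp only [Equiv.prodComm_apply, Prod.swap_prod_mk]
    rw [hanti α β, neg_mul]

omit [IsProbabilityMeasure μ] in
theorem tsum_mul_pairFlux_of_symmetric (hsymm : IsSymmetric p)
    (hanti : ∀ α β, flux g (fun n => μ.real {n}) (β, α) = -flux g (fun n => μ.real {n}) (α, β)) :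
    ∑' q : X × X, p q.1 q.2 * pairFlux g μ f q.1 q.2 = 0 := by
  have h : ∑' q : X × X, p q.1 q.2 * pairFlux g μ f q.1 q.2 =
      -∑' q : X × X, p q.1 q.2 * pairFlux g μ f q.1 q.2 := by
    conv_lhs => rw [← (Equiv.prodComm X X).tsum_eq]
    rw [← tsum_neg]
    refine tsum_congr fun ⟨u, v⟩ => ?_
    simp only [Equiv.prodComm_apply, Prod.swap_prod_mk]
    rw [pairFlux_swap hanti u v, hsymm v u, mul_neg]
  linarith

/-- The covariance-like weight of the occupation number at `u`. -/
noncomputable def siteFlux (μ : Measure ℕ) (ψ : ℕ → ℝ) (f : (X → ℕ) → ℝ) (u : X) : ℝ :=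
  ∑' n, μ.real {n} * ψ n * siteMean μ f u n

theorem hasSum_pairMean_eq_siteFlux (hf : Measurable f) (hB : ∀ η, |f η| ≤ B) {ψ : ℕ → ℝ}
    (hψ : Summable fun n => μ.real {n} * ψ n) (u v : X) :
    HasSum (fun q : ℕ × ℕ => μ.real {q.1} * μ.real {q.2} * ψ q.2 * pairMean μ f u v q)
      (siteFlux μ ψ f v) := by
  have hmμ : Summable fun n => μ.real {n} := by
    simpa using (hasSum_integral_countable (integrable_const (μ := μ) (1 : ℝ))).summable
  have hs : Summable fun q : ℕ × ℕ =>
      μ.real {q.1} * μ.real {q.2} * ψ q.2 * pairMean μ f u v q := by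
    have h1 := hmμ.abs.mul_of_nonneg hψ.abs (fun _ => abs_nonneg _) (fun _ => abs_nonneg _)
    refine Summable.of_norm_bounded (h1.mul_right B) fun q => ?_
    rw [Real.norm_eq_abs, mul_assoc (μ.real {q.1}), abs_mul, abs_mul]
    exact mul_le_mul_of_nonneg_left (abs_pairMean_le hB u v q) (by positivity)
  have h2 := (Equiv.prodComm ℕ ℕ).hasSum_iff.2 hs.hasSum
  have h3 := h2.prod_fiberwise (g := fun n => μ.real {n} * ψ n * siteMean μ f v n) fun n => by
    have hmeas : Measurable fun η : X → ℕ => f (Function.update η v n) :=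
      hf.comp (measurable_update'.comp (measurable_id.prodMk measurable_const))
    have h4 := hasSum_siteMean (μ := μ) (f := fun η => f (Function.update η v n))
      (Integrable.of_bound hmeas.aestronglyMeasurable B (Filter.Eventually.of_forall fun η => hB _))
      u
    refine (h4.mul_left (μ.real {n} * ψ n)).congr_fun fun k => ?_
    simp only [Function.comp, Equiv.prodComm_apply, Prod.swap_prod_mk, siteMean, pairMean]
    ring
  rw [siteFlux, h3.tsum_eq]
  exact hs.hasSum

/-- In `μ(α)μ(β)(ψ(β) - ψ(α))` each term involves one site only, so the mean over the other site is
free and a difference of one-site quantities remains. -/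
theorem pairFlux_eq_sub (hf : Measurable f) (hB : ∀ η, |f η| ≤ B) {ψ : ℕ → ℝ}
    (hψ : Summable fun n => μ.real {n} * ψ n)
    (hflux : ∀ α β, flux g (fun n => μ.real {n}) (α, β) =
      μ.real {α} * μ.real {β} * (ψ β - ψ α)) (u v : X) :
    pairFlux g μ f u v = siteFlux μ ψ f v - siteFlux μ ψ f u := by
  by_cases huv : u = v
  · rw [huv, pairFlux_self, sub_self]
  · have h1 := hasSum_pairMean_eq_siteFlux hf hB hψ u v
    have h2 := (Equiv.prodComm ℕ ℕ).hasSum_iff.2 (hasSum_pairMean_eq_siteFlux hf hB hψ v u)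
    rw [pairFlux, if_neg huv, ← (h1.sub h2).tsum_eq]
    refine tsum_congr fun ⟨α, β⟩ => ?_
    simp only [Function.comp, Equiv.prodComm_apply, Prod.swap_prod_mk]
    rw [hflux, pairMean_swap huv, Prod.swap_prod_mk]
    ring

omit [IsProbabilityMeasure μ] in
theorem siteFlux_eq_of_notMem (hf : DependsOn f (Λ : Set X)) {u : X} (hu : u ∉ Λ) (ψ : ℕ → ℝ) :
    siteFlux μ ψ f u = (∑' n, μ.real {n} * ψ n) *
      ∫ η, f η ∂(Measure.infinitePi fun _ : X => μ) := by
  rw [siteFlux, ← tsum_mul_right]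
  refine tsum_congr fun n => ?_
  congr 1
  refine integral_congr_ae (Filter.Eventually.of_forall fun η => hf fun x hx => ?_)
  have : x ≠ u := fun h => hu (h ▸ hx)
  simp [this]

theorem summable_mul_of_flux (hg : IsRate g) (hC : GrowthBound g C)
    (hμ : Integrable (fun n : ℕ => (n : ℝ)) μ) {ψ : ℕ → ℝ}
    (hflux : ∀ α β, flux g (fun n => μ.real {n}) (α, β) =
      μ.real {α} * μ.real {β} * (ψ β - ψ α)) : Summable fun n => μ.real {n} * ψ n := by
  have hm := isMarginal_measureReal hμ
  -- Integrability of `ψ` is not assumed. It is read off the summable flux along the line of a value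
  -- `α` of positive mass.
  obtain ⟨α, hα⟩ : ∃ α, μ.real {α} ≠ 0 := by
    by_contra! h
    have := hm.hasSum
    simp only [h] at this
    exact zero_ne_one (hasSum_zero.unique this)
  have h1 := hm.summable_flux_mul hg hC (F := fun _ => 1) (B := 1) (by simp)
  have h2 := (h1.comp_injective (Prod.mk_right_injective α)).mul_left (μ.real {α})⁻¹
  refine (h2.add (hm.hasSum.summable.mul_left (ψ α))).congr fun n => ?_
  simp only [Function.comp, mul_one, hflux]
  field_simp
  ring

theorem hasSum_mul_pairFlux_of_flux (hp : IsTransitionProbability p)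
    (hcol : ∀ y, HasSum (fun x => p x y) 1) (hg : IsRate g) (hC : GrowthBound g C)
    (hμ : Integrable (fun n : ℕ => (n : ℝ)) μ) {ψ : ℕ → ℝ}
    (hflux : ∀ α β, flux g (fun n => μ.real {n}) (α, β) =
      μ.real {α} * μ.real {β} * (ψ β - ψ α))
    (hf : DependsOn f (Λ : Set X)) (hB : ∀ η, |f η| ≤ B) :
    HasSum (fun q : X × X => p q.1 q.2 * pairFlux g μ f q.1 q.2) 0 := by
  have hψ := summable_mul_of_flux hg hC hμ hflux
  set c := (∑' n, μ.real {n} * ψ n) * ∫ η, f η ∂(Measure.infinitePi fun _ : X => μ)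
  -- Off `Λ` the value at `u` is independent of `f`, so subtracting the constant `c` leaves finite
  -- support without changing differences.
  have hs : Summable fun u => siteFlux μ ψ f u - c :=
    summable_of_ne_finset_zero (s := Λ) fun u hu => by
      rw [siteFlux_eq_of_notMem hf hu, sub_self]
  refine (hasSum_mul_sub hp hcol hs).congr_fun fun q => ?_
  rw [pairFlux_eq_sub (measurable_of_dependsOn hf) hB hψ hflux]
  ring

end Sufficiency

/-! ### The two equivalences in terms of `A`. -/

section Main

variable {X : Type*} [DecidableEq X] [Countable X] [Nontrivial X] {p : X → X → ℝ}
  {g : ℕ → ℕ → ℕ → ℝ} {a : X → ℝ} {C : ℝ} {μ : Measure ℕ} [IsProbabilityMeasure μ]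
  {P : ℝ≥0 → Kernel (Config a) (Config a)}

theorem IsInvariant.supportCondition (hA : Admissible p g a C) (hirr : IsIrreducible p)
    (hP : IsProcess p g P) (hμ : Integrable (fun n : ℕ => (n : ℝ)) μ)
    (h : IsInvariant P (Measure.infinitePi fun _ : X => μ)) :
    SupportCondition g fun n => μ.real {n} := by
  obtain ⟨x⟩ := (inferInstance : Nonempty X)
  obtain ⟨y, hyx, hpos⟩ := hirr.exists_pos x
  exact supportCondition_of_hasSum hA.prob hA.rate hμ
    ((isInvariant_infinitePi_iff hA hμ hP).1 h) hyx.symm hpos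

theorem IsInvariant.flux_balance (hA : Admissible p g a C) (hirr : IsIrreducible p)
    (hP : IsProcess p g P) (hμ : Integrable (fun n : ℕ => (n : ℝ)) μ)
    (h : IsInvariant P (Measure.infinitePi fun _ : X => μ)) :
    ∃ r : ℕ → ℝ, ∀ x y : X, x ≠ y → ∀ α β : ℕ,
      p x y * (flux g (fun n => μ.real {n}) (α, β) - (r α * μ.real {β} - r β * μ.real {α})) +
      p y x * (flux g (fun n => μ.real {n}) (β, α) - (r β * μ.real {α} - r α * μ.real {β})) = 0 :=
  MMP.flux_balance hA.prob hA.col (hA.prob.self_lt_one hirr) hA.rate hA.growth hμ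
    ((isInvariant_infinitePi_iff hA hμ hP).1 h)

theorem A_of_mul_eq_zero {m : ℕ → ℝ} {α β : ℕ} (h : m α * m β = 0) : A g m α β = 0 :=
  if_neg (not_not.2 h)

theorem IsInvariant.A_antisymm (hA : Admissible p g a C) (hirr : IsIrreducible p)
    (hP : IsProcess p g P) (hμ : Integrable (fun n : ℕ => (n : ℝ)) μ)
    (h : IsInvariant P (Measure.infinitePi fun _ : X => μ)) (α β : ℕ) :
    A g (fun n => μ.real {n}) α β = -A g (fun n => μ.real {n}) β α := by
  have hsupp := h.supportCondition hA hirr hP hμ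
  obtain ⟨r, hr⟩ := h.flux_balance hA hirr hP hμ
  obtain ⟨x⟩ := (inferInstance : Nonempty X)
  obtain ⟨y, hyx, hpos⟩ := hirr.exists_pos x
  by_cases h0 : μ.real {α} * μ.real {β} = 0
  · rw [A_of_mul_eq_zero h0, A_of_mul_eq_zero (by rwa [mul_comm]), neg_zero]
  · have h1 := hr x y hyx.symm α β
    have h2 := hr x y hyx.symm β α
    rw [hsupp.flux_eq, hsupp.flux_eq] at h1 h2
    -- The terms with `r` are antisymmetric in `α`, `β` and cancel in the sum.
    have h3 : (p x y + p y x) * (μ.real {α} * μ.real {β} *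
        (A g (fun n => μ.real {n}) α β + A g (fun n => μ.real {n}) β α)) = 0 := by
      linear_combination h1 + h2
    have hne : p x y + p y x ≠ 0 := (add_pos_of_pos_of_nonneg hpos (hA.prob.nonneg _ _)).ne'
    have h4 := (mul_eq_zero.1 ((mul_eq_zero.1 h3).resolve_left hne)).resolve_left h0
    linarith

theorem IsInvariant.exists_potential (hA : Admissible p g a C) (hirr : IsIrreducible p)
    (hP : IsProcess p g P) (hμ : Integrable (fun n : ℕ => (n : ℝ)) μ) (hns : ¬ IsSymmetric p)
    (h : IsInvariant P (Measure.infinitePi fun _ : X => μ)) :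
    ∃ ψ : ℕ → ℝ, ∀ α β : ℕ, μ.real {α} * μ.real {β} ≠ 0 →
      A g (fun n => μ.real {n}) α β = ψ β - ψ α := by
  have hsupp := h.supportCondition hA hirr hP hμ
  obtain ⟨r, hr⟩ := h.flux_balance hA hirr hP hμ
  simp only [IsSymmetric, not_forall] at hns
  obtain ⟨x, y, hne⟩ := hns
  have hxy : x ≠ y := fun h => hne (by rw [h])
  refine ⟨fun n => -(r n / μ.real {n}), fun α β h0 => ?_⟩
  have hα := left_ne_zero_of_mul h0
  have hβ := right_ne_zero_of_mul h0
  have h1 := hr x y hxy α β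
  have h2 := hr x y hxy β α
  rw [hsupp.flux_eq, hsupp.flux_eq] at h1 h2
  -- The balance equations for `(α, β)` and `(β, α)` form a linear system in the two defects, with
  -- determinant `p x y ^ 2 - p y x ^ 2`.
  have h3 : (p x y - p y x) * (p x y + p y x) * (μ.real {α} * μ.real {β} *
      A g (fun n => μ.real {n}) α β - (r α * μ.real {β} - r β * μ.real {α})) = 0 := by
    linear_combination p x y * h1 - p y x * h2
  have hsum : p x y + p y x ≠ 0 := fun hs => hne (by
    have := hA.prob.nonneg x y
    have := hA.prob.nonneg y x
    linarith)
  have h4 := (mul_eq_zero.1 h3).resolve_left (mul_ne_zero (sub_ne_zero.2 hne) hsum)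
  field_simp
  linear_combination h4

omit [Nontrivial X] in
theorem isInvariant_of_symmetric (hA : Admissible p g a C) (hP : IsProcess p g P)
    (hμ : Integrable (fun n : ℕ => (n : ℝ)) μ) (hsymm : IsSymmetric p)
    (hsupp : SupportCondition g fun n => μ.real {n})
    (hanti : ∀ α β, A g (fun n => μ.real {n}) α β = -A g (fun n => μ.real {n}) β α) :
    IsInvariant P (Measure.infinitePi fun _ : X => μ) := by
  refine (isInvariant_infinitePi_iff hA hμ hP).2 fun Λ f hf ⟨B, hB⟩ => ?_
  have h := (summable_mul_pairFlux hA hμ hf hB).hasSum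
  rwa [tsum_mul_pairFlux_of_symmetric hsymm fun α β => by
    rw [hsupp.flux_eq, hsupp.flux_eq, hanti α β]; ring] at h

omit [Nontrivial X] in
theorem isInvariant_of_potential (hA : Admissible p g a C) (hP : IsProcess p g P)
    (hμ : Integrable (fun n : ℕ => (n : ℝ)) μ)
    (hsupp : SupportCondition g fun n => μ.real {n}) {ψ : ℕ → ℝ}
    (hψ : ∀ α β : ℕ, μ.real {α} * μ.real {β} ≠ 0 →
      A g (fun n => μ.real {n}) α β = ψ β - ψ α) :
    IsInvariant P (Measure.infinitePi fun _ : X => μ) := by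
  refine (isInvariant_infinitePi_iff hA hμ hP).2 fun Λ f hf ⟨B, hB⟩ =>
    hasSum_mul_pairFlux_of_flux hA.prob hA.col hA.rate hA.growth hμ (ψ := ψ) (fun α β => ?_) hf hB
  by_cases h0 : μ.real {α} * μ.real {β} = 0
  · rw [hsupp.flux_eq, h0, zero_mul, zero_mul]
  · rw [hsupp.flux_eq, hψ α β h0]

end Main

end MMP

theorem theorem3p1 (d : ℕ) (hd : 1 ≤ d)
    (p : (Fin d → ℤ) → (Fin d → ℤ) → ℝ)
    (hp : MMP.IsTransitionProbability p) (hirr : MMP.IsIrreducible p)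
    (hti : MMP.IsTranslationInvariant p)
    (g : ℕ → ℕ → ℕ → ℝ) (hg : MMP.IsRate g) (hgrowth : MMP.LinearGrowth g)
    (a : (Fin d → ℤ) → ℝ) (ha : MMP.IsWeight p a)
    (P : ℝ≥0 → Kernel (MMP.Config a) (MMP.Config a)) (hP : MMP.IsProcess p g P)
    (μ : Measure ℕ) [IsProbabilityMeasure μ] (hμ : Integrable (fun n : ℕ => (n : ℝ)) μ)
    (m : ℕ → ℝ) (hm : ∀ n, m n = μ.real {n})
    (ν : Measure ((Fin d → ℤ) → ℕ)) (hν : ν = Measure.infinitePi (fun _ => μ)) :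
    (MMP.IsInvariant P ν →
      MMP.SupportCondition g m ∧ ∀ α β : ℕ, MMP.A g m α β = -MMP.A g m β α) ∧
    (MMP.IsSymmetric p →
      (MMP.IsInvariant P ν ↔
        MMP.SupportCondition g m ∧ ∀ α β : ℕ, MMP.A g m α β = -MMP.A g m β α)) ∧
    (¬ MMP.IsSymmetric p →
      (MMP.IsInvariant P ν ↔
        MMP.SupportCondition g m ∧
          ∃ ψ : ℕ → ℝ, ∀ α β : ℕ, m α * m β ≠ 0 → MMP.A g m α β = ψ β - ψ α)) := by
  obtain rfl : m = fun n => μ.real {n} := funext hm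
  subst hν
  obtain ⟨C, hC⟩ := hgrowth.exists_growthBound
  have hA : MMP.Admissible p g a C := ⟨hp, hti.hasSum_col hp, ha, hg, hC⟩
  -- This makes the lattice nontrivial, so that two distinct sites exist.
  have : Nonempty (Fin d) := ⟨⟨0, hd⟩⟩
  have hnec : MMP.IsInvariant P (Measure.infinitePi fun _ => μ) →
      MMP.SupportCondition g (fun n => μ.real {n}) ∧ ∀ α β : ℕ,
        MMP.A g (fun n => μ.real {n}) α β = -MMP.A g (fun n => μ.real {n}) β α :=
    fun h => ⟨h.supportCondition hA hirr hP hμ, h.A_antisymm hA hirr hP hμ⟩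
  refine ⟨hnec, fun hsymm => ⟨hnec, fun h => ?_⟩, fun hns => ⟨fun h => ?_, ?_⟩⟩
  · exact MMP.isInvariant_of_symmetric hA hP hμ hsymm h.1 h.2
  · exact ⟨h.supportCondition hA hirr hP hμ, h.exists_potential hA hirr hP hμ hns⟩
  · rintro ⟨hsupp, ψ, hψ⟩
    exact MMP.isInvariant_of_potential hA hP hμ hsupp hψ
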